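/- Let $K$ be an algebraically closed field of characteristic zero and order the monomials of $S=K[x_1,\ldots,x_n]$ by the (degree) reverse lexicographic order $>_{\mathrm{revlex}}$ with $x_1>\cdots>x_n$: $x^a>_{\mathrm{revlex}}x^b$ if $\deg x^a>\deg x^b$, or if the degrees agree and $a_i<b_i$ for the last index $i$ with $a_i\ne b_i$. For an ideal $I\subset S$ let $\mathrm{in}(I)$ be the ideal generated by the leading monomials of the nonzero elements of $I$. The generic initial ideal $\mathrm{Gin}(I)$ is the ideal $J$ such that $\mathrm{in}(gI)=J$ for all $g=(g_{ij})$ in a nonempty Zariski open subset of $GL_n(K)$, where $g$ acts on $S$ by $x_i\mapsto\sum_j g_{ij}x_j$. For an ideal $J$ let $J_k$ be the set of monomials of degree $k$ in $J$. A set $M$ of monomials of the same degree $k$ is called a revlex set if, whenever $u\in M$ and $v$ is a monomial of degree $k$ with $v>_{\mathrm{revlex}}u$, also $v\in M$. (a) Let $d\ge 2$, let $f_1,f_2,f_3\in K[x_1,x_2,x_3]$ be a regular sequence of homogeneous polynomials of degree $d$, and let $I=(f_1,f_2,f_3)$. Then $J=\mathrm{Gin}(I)$ exists and $J_d$ is a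 revlex set. (b) Let $f_1,f_2,f_3,f_4\in K[x_1,x_2,x_3,x_4]$ be a regular sequence of homogeneous polynomials of degree $2$, and let $I=(f_1,f_2,f_3,f_4)$. Then $J=\mathrm{Gin}(I)$ exists and $J_2$ is a revlex set. -/

import Mathlib

open MvPolynomial

noncomputable section

/-- The exponent vectors of the monomials in `x_0 > x_1 > ⋯ > x_{n-1}`, to be ordered by the
(degree) reverse lexicographic order. -/
def RevlexExp (n : ℕ) : Type := Fin n →₀ ℕ

namespace RevlexExp

variable {n : ℕ}

instance : AddCommMonoid (RevlexExp n) := inferInstanceAs (AddCommMonoid (Fin n →₀ ℕ))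

/-- The identity, as an additive equivalence. -/
def ofExp (n : ℕ) : (Fin n →₀ ℕ) ≃+ RevlexExp n := AddEquiv.refl _

/-- The total degree, followed by the exponents read from the last variable to the first one,
each with the reversed order. -/
def key (a : RevlexExp n) : ℕ ×ₗ Lex (Fin n → ℕᵒᵈ) :=
  toLex (((ofExp n).symm a).degree,
    toLex fun i => OrderDual.toDual ((ofExp n).symm a (Fin.rev i)))

theorem key_injective : Function.Injective (key (n := n)) := by
  intro a b h
  have h2 := congrArg (fun z => (ofLex z).2) h
  have h3 : ∀ i : Fin n, (ofExp n).symm a i = (ofExp n).symm b i := by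
    intro i
    have := congrFun (congrArg (fun z => ofLex z) h2) (Fin.rev i)
    simpa [key] using this
  exact (ofExp n).symm.injective (Finsupp.ext h3)

instance : LinearOrder (RevlexExp n) := LinearOrder.lift' key key_injective

theorem lt_def {a b : RevlexExp n} : a < b ↔ key a < key b := Iff.rfl

/-- The reverse lexicographic order: `x^a < x^b` if and only if `deg x^a < deg x^b`, or the degrees
agree and, for the last index `i` with `a i ≠ b i`, one has `a i > b i`. -/
theorem lt_iff {a b : Fin n →₀ ℕ} :
    ofExp n a < ofExp n b ↔ a.degree < b.degree ∨
      (a.degree = b.degree ∧ ∃ i, b i < a i ∧ ∀ j, i < j → a j = b j) := by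
  rw [lt_def, Prod.Lex.lt_iff]
  refine or_congr Iff.rfl (and_congr Iff.rfl ?_)
  constructor
  · rintro ⟨i, h1, h2⟩
    refine ⟨Fin.rev i, h2, fun j hj => ?_⟩
    have := h1 (Fin.rev j) (by simpa using Fin.rev_lt_rev.2 hj)
    simpa [key] using this
  · rintro ⟨i, h1, h2⟩
    refine ⟨Fin.rev i, fun j hj => ?_, ?_⟩
    · have := h2 (Fin.rev j) (by simpa using Fin.rev_lt_rev.2 hj)
      simpa [key] using this
    · simpa [key] using h1

theorem add_lt_add_iff {a b : Fin n →₀ ℕ} (c : Fin n →₀ ℕ) :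
    ofExp n a + ofExp n c < ofExp n b + ofExp n c ↔ ofExp n a < ofExp n b := by
  rw [← map_add, ← map_add, lt_iff, lt_iff]
  simp

instance : IsOrderedAddMonoid (RevlexExp n) where
  add_le_add_left a b h c := by
    rcases h.eq_or_lt with h | h
    · rw [h]
    · exact ((add_lt_add_iff (a := (ofExp n).symm a) (b := (ofExp n).symm b)
        ((ofExp n).symm c)).2 h).le

instance : WellFoundedLT (RevlexExp n) := by
  refine ⟨⟨fun a => ?_⟩⟩
  have key : ∀ d : ℕ, ∀ a : RevlexExp n, ((ofExp n).symm a).degree ≤ d → Acc (· < ·) a := by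
    intro d a ha
    have hfin : {b : RevlexExp n | ((ofExp n).symm b).degree ≤ d}.Finite :=
      Finsupp.finite_of_degree_le (σ := Fin n) d
    have hwf := hfin.wellFoundedOn (r := ((· < ·) : RevlexExp n → RevlexExp n → Prop))
    refine (Set.wellFoundedOn_iff.1 hwf).induction (C := fun a =>
      ((ofExp n).symm a).degree ≤ d → Acc (· < ·) a) a (fun x ih hx => ?_) ha
    refine Acc.intro _ fun y hy => ?_
    have hyd : ((ofExp n).symm y).degree ≤ d := by
      rcases (lt_iff (a := (ofExp n).symm y) (b := (ofExp n).symm x)).1 hy with h | h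
      · omega
      · omega
    exact ih y ⟨hy, hyd, hx⟩ hyd
  exact key _ a le_rfl

end RevlexExp

/-- The (degree) reverse lexicographic order on the monomials in `n` variables
`x_0 > x_1 > ⋯ > x_{n-1}`. -/
def revlex (n : ℕ) : MonomialOrder (Fin n) where
  syn := RevlexExp n
  toSyn := RevlexExp.ofExp n
  toSyn_monotone a b h := by
    by_contra hlt
    rcases RevlexExp.lt_iff.1 (not_le.1 hlt) with h1 | ⟨h0, i, h1, -⟩
    · exact absurd (Finsupp.degree_mono h) (not_le.2 h1)
    · have h2 : b.degree = a.degree + (b - a).degree := by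
        rw [← map_add, add_tsub_cancel_of_le h]
      have h3 : b - a = 0 := (Finsupp.degree_eq_zero_iff _).1 (by omega)
      have h4 := DFunLike.congr_fun h3 i
      simp only [Finsupp.coe_tsub, Pi.sub_apply, Finsupp.coe_zero, Pi.zero_apply] at h4
      omega

/-- The initial ideal of `I` with respect to the reverse lexicographic order. -/
def initialIdeal {K : Type*} [Field K] {n : ℕ} (I : Ideal (MvPolynomial (Fin n) K)) :
    Ideal (MvPolynomial (Fin n) K) :=
  Ideal.span ((revlex n).leadingTerm '' (I : Set (MvPolynomial (Fin n) K)))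

/-- The linear change of coordinates `x_i ↦ ∑ j, g i j * x_j`. -/
def coordChange {K : Type*} [Field K] {n : ℕ} (g : GL (Fin n) K) :
    MvPolynomial (Fin n) K →ₐ[K] MvPolynomial (Fin n) K :=
  aeval fun i => ∑ j, C (g.val i j) * X j

/-- `U` is open in the Zariski topology of `GL_n(K)`, that is, it is the set of the invertible
matrices at which not all of a given set of polynomials in the matrix entries vanish. -/
def IsZariskiOpen {K : Type*} [Field K] {n : ℕ} (U : Set (GL (Fin n) K)) : Prop :=
  ∃ T : Set (MvPolynomial (Fin n × Fin n) K),
    U = {g | ∃ p ∈ T, eval (fun ij => g.val ij.1 ij.2) p ≠ 0}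

/-- `J` is the generic initial ideal of `I` with respect to the reverse lexicographic order:
`J` is the initial ideal of `g I` for all `g` in a nonempty Zariski open subset of `GL_n(K)`. -/
def IsGin {K : Type*} [Field K] {n : ℕ} (I J : Ideal (MvPolynomial (Fin n) K)) : Prop :=
  ∃ U : Set (GL (Fin n) K), IsZariskiOpen U ∧ U.Nonempty ∧
    ∀ g ∈ U, initialIdeal (I.map (coordChange g)) = J

/-- The set `J_k` of (the exponents of) the monomials of degree `k` in `J`. -/
def monomialsOfDegree {K : Type*} [Field K] {n : ℕ} (J : Ideal (MvPolynomial (Fin n) K)) (k : ℕ) :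
    Set (Fin n →₀ ℕ) :=
  {u | u.degree = k ∧ monomial u (1 : K) ∈ J}

open scoped MonomialOrder in
/-- A set of monomials is a revlex set if, with a monomial `u`, it contains every monomial of the
same degree that is greater than `u` in the reverse lexicographic order. -/
def IsRevlexSet {n : ℕ} (M : Set (Fin n →₀ ℕ)) : Prop :=
  ∀ u ∈ M, ∀ v : Fin n →₀ ℕ, v.degree = u.degree → u ≺[revlex n] v → v ∈ M

end

/-! Let V be the span of the given forms. For a finite set N of exponents, the rank of the
coefficients at N on gV is maximal for all g in a nonempty Zariski open set. Take such a g, put W =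
gV, and let v ∈ W have no monomial in N. Deform W by x_j ↦ x_j + t x_i. The image of v, divided by
t, has coefficients at N tending to those of x_i ∂_j v as t → 0. By maximality of the rank these
already occur at N for some w ∈ W (`IsRankGeneric.exists_coeff_eq`).

If N is an upper set for revlex, this makes the leading exponents of W strongly stable in
characteristic zero (`IsGenericInDegree.add_single_mem_leadExps`). The decisive use is
`IsGenericInDegree.last_eq_zero`. Suppose the last variable x_n of x_0, …, x_n divides the leading
monomial of v ∈ W. In revlex every monomial of v then has at least the same exponent of x_n. Taking
for N the monomials with smaller exponent yields, for every j, some w_j ∈ W with w_j ≡ x_j ∂_n v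
modulo x_n, and with distinct leading monomials. Since dim W ≤ n + 1, the w_j span W, so W vanishes
at any zero of ∂_n v on the hyperplane x_n = 0. But a regular sequence of as many forms as variables
has no nontrivial common zero, by dimension theory.

So the leading monomials avoid the last variable. With three variables, strong stability in the
remaining two gives a revlex set. For quadrics in four variables, strong stability leaves only x_1²
and x_0x_2 incomparable, and dim W = 4 forces x_1² into the set.

Gin exists because the leading exponents in each degree are determined by coefficient ranks, and
finitely many degrees suffice by noetherianity. -/

noncomputable section

/-! ### Openness of linear independence -/

/-- Linear independence of a family of vectors whose coordinates are regular functions is an open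
condition. -/
theorem exists_mem_subalgebra_linearIndependent {K X ι N : Type*} [Field K] [Fintype ι]
    [Fintype N] (P : Subalgebra K (X → K)) (F : X → ι → N → K)
    (hF : ∀ i u, (fun x => F x i u) ∈ P) (x₀ : X) (h : LinearIndependent K (F x₀)) :
    ∃ p ∈ P, p x₀ ≠ 0 ∧ ∀ x, p x ≠ 0 → LinearIndependent K (F x) := by
  classical
  obtain ⟨L, hL⟩ := LinearMap.exists_leftInverse_of_injective
    (Fintype.linearCombination K (F x₀))
    (LinearMap.ker_eq_bot.2 (linearIndependent_iff_injective_fintypeLinearCombination.1 h))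
  have hL' : ∀ i, L (F x₀ i) = Pi.single i 1 := fun i => by
    have := LinearMap.congr_fun hL (Pi.single i 1)
    simpa [Fintype.linearCombination_apply_single] using this
  have hexp : ∀ (y : N → K) (j : ι), L y j = ∑ u, y u * L (Pi.single u 1) j := fun y j => by
    conv_lhs => rw [← Finset.univ_sum_single y]
    rw [map_sum, Finset.sum_apply]
    refine Finset.sum_congr rfl fun u _ => ?_
    rw [← smul_eq_mul, ← Pi.smul_apply, ← map_smul, ← Pi.single_smul, smul_eq_mul, mul_one]
  -- A left inverse `L` of the combination map at `x₀` turns the family into a square matrix, equal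
  -- to the identity at `x₀`; its determinant is the required function.
  refine ⟨fun x => (Matrix.of fun i j => L (F x i) j).det, ?_, ?_, fun x hx => ?_⟩
  · have : (fun x => (Matrix.of fun i j => L (F x i) j).det) =
        ∑ σ : Equiv.Perm ι, (Equiv.Perm.sign σ : ℤ) • ∏ i, fun x => L (F x (σ i)) i := by
      ext x
      simp [Matrix.det_apply, Units.smul_def]
    rw [this]
    refine Subalgebra.sum_mem _ fun σ _ => Subalgebra.zsmul_mem _ (Subalgebra.prod_mem _ ?_) _
    intro i _
    have : (fun x => L (F x (σ i)) i) =
        ∑ u, L (Pi.single u 1) i • fun x => F x (σ i) u := by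
      ext x
      rw [hexp]
      simp [mul_comm]
    rw [this]
    exact Subalgebra.sum_mem _ fun u _ => Subalgebra.smul_mem _ (hF _ _) _
  · have : (Matrix.of fun i j => L (F x₀ i) j) = 1 := by
      ext i j
      simp [hL', Matrix.one_apply, Pi.single_apply, eq_comm]
    simp [this]
  · have := Matrix.linearIndependent_rows_of_det_ne_zero hx
    exact LinearIndependent.of_comp L this

/-! ### Linear changes of coordinates and polynomial functions on GL_n -/

section CoordChange

variable {K : Type*} [Field K] {n : ℕ}

/-- The regular functions on `GL_n(K)` that are polynomials in the matrix entries. -/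
def glPolynomials (K : Type*) [Field K] (n : ℕ) : Subalgebra K (GL (Fin n) K → K) :=
  (aeval fun (ij : Fin n × Fin n) (g : GL (Fin n) K) => g.val ij.1 ij.2).range

theorem mem_glPolynomials {p : GL (Fin n) K → K} :
    p ∈ glPolynomials K n ↔ ∃ q : MvPolynomial (Fin n × Fin n) K,
      ∀ g, p g = eval (fun ij => g.val ij.1 ij.2) q := by
  have key : ∀ (q : MvPolynomial (Fin n × Fin n) K) (g : GL (Fin n) K),
      aeval (fun (ij : Fin n × Fin n) (g : GL (Fin n) K) => g.val ij.1 ij.2) q g =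
        eval (fun ij => g.val ij.1 ij.2) q := fun q g => by
    induction q using MvPolynomial.induction_on with
    | C a => simp only [MvPolynomial.algHom_C, eval_C]; rfl
    | add p q hp hq => simp only [map_add, Pi.add_apply, hp, hq]
    | mul_X p i hp => simp only [map_mul, Pi.mul_apply, hp, aeval_X, eval_X]
  refine ⟨?_, ?_⟩
  · rintro ⟨q, rfl⟩
    exact ⟨q, key q⟩
  · rintro ⟨q, hq⟩
    refine ⟨q, ?_⟩
    funext g
    rw [hq]
    exact key q g

theorem entry_mem_glPolynomials (i j : Fin n) :
    (fun g : GL (Fin n) K => g.val i j) ∈ glPolynomials K n :=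
  mem_glPolynomials.2 ⟨X (i, j), fun g => by simp⟩

/-- `GL_n(K)` is irreducible. -/
theorem mul_ne_zero_of_mem_glPolynomials [Infinite K] {p q : GL (Fin n) K → K}
    (hp : p ∈ glPolynomials K n) (hq : q ∈ glPolynomials K n) (hp0 : p ≠ 0) (hq0 : q ≠ 0) :
    p * q ≠ 0 := by
  obtain ⟨P, hP⟩ := mem_glPolynomials.1 hp
  obtain ⟨Q, hQ⟩ := mem_glPolynomials.1 hq
  have hP0 : P ≠ 0 := by
    rintro rfl
    exact hp0 (funext fun g => by simp [hP])
  have hQ0 : Q ≠ 0 := by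
    rintro rfl
    exact hq0 (funext fun g => by simp [hQ])
  -- The factor `D` forces a matrix at which the product does not vanish to be invertible.
  let D : MvPolynomial (Fin n × Fin n) K := (Matrix.of fun i j => X (i, j)).det
  have hD : ∀ A : Matrix (Fin n) (Fin n) K, eval (fun ij => A ij.1 ij.2) D = A.det := fun A => by
    rw [RingHom.map_det]
    congr 1
    ext i j
    simp
  have hD0 : D ≠ 0 := fun h => by
    have := hD 1
    simp [h] at this
  have hne : P * Q * D ≠ 0 := mul_ne_zero (mul_ne_zero hP0 hQ0) hD0
  obtain ⟨x, hx⟩ : ∃ x, eval x (P * Q * D) ≠ 0 := by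
    by_contra! hcon
    exact hne (MvPolynomial.funext fun x => by simpa using hcon x)
  let A : Matrix (Fin n) (Fin n) K := Matrix.of fun i j => x (i, j)
  have hA : (fun ij : Fin n × Fin n => A ij.1 ij.2) = x := rfl
  rw [map_mul, map_mul, ← hA, hD] at hx
  have hdet : A.det ≠ 0 := right_ne_zero_of_mul hx
  intro h
  have := congrFun h (Matrix.GeneralLinearGroup.mkOfDetNeZero A hdet)
  rw [Pi.mul_apply, hP, hQ] at this
  exact left_ne_zero_of_mul hx this

theorem prod_ne_zero_of_mem_glPolynomials [Infinite K] {ι : Type*} (s : Finset ι)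
    (p : ι → GL (Fin n) K → K) (hp : ∀ i ∈ s, p i ∈ glPolynomials K n) (h0 : ∀ i ∈ s, p i ≠ 0) :
    ∏ i ∈ s, p i ≠ 0 := by
  classical
  induction s using Finset.induction_on with
  | empty =>
    intro h
    simpa using congrFun h 1
  | insert a s ha ih =>
    rw [Finset.prod_insert ha]
    refine mul_ne_zero_of_mem_glPolynomials (hp a (by simp)) (Subalgebra.prod_mem _ fun i hi =>
      hp i (by simp [hi])) (h0 a (by simp)) (ih (fun i hi => hp i (by simp [hi]))
        fun i hi => h0 i (by simp [hi]))

@[simp]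
theorem coordChange_X (g : GL (Fin n) K) (i : Fin n) :
    coordChange g (X i) = ∑ j, C (g.val i j) * X j := by
  simp [coordChange]

theorem coordChange_mul (g h : GL (Fin n) K) (p : MvPolynomial (Fin n) K) :
    coordChange (h * g) p = coordChange g (coordChange h p) := by
  have : (coordChange (h * g)) = (coordChange g).comp (coordChange h) := by
    refine algHom_ext fun i => ?_
    simp only [coordChange_X, AlgHom.comp_apply, map_sum, map_mul, Units.val_mul,
      Matrix.mul_apply, Finset.sum_mul, Finset.mul_sum, MvPolynomial.algHom_C,
      MvPolynomial.algebraMap_eq]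
    rw [Finset.sum_comm]
    simp [mul_assoc]
  rw [this]
  rfl

theorem coordChange_one (p : MvPolynomial (Fin n) K) : coordChange (1 : GL (Fin n) K) p = p := by
  have : coordChange (1 : GL (Fin n) K) = AlgHom.id K _ := by
    refine algHom_ext fun i => ?_
    simp [Matrix.one_apply]
  rw [this]
  rfl

theorem coordChange_inv_apply (g : GL (Fin n) K) (p : MvPolynomial (Fin n) K) :
    coordChange g⁻¹ (coordChange g p) = p := by
  rw [← coordChange_mul, mul_inv_cancel, coordChange_one]

theorem coordChange_apply_inv (g : GL (Fin n) K) (p : MvPolynomial (Fin n) K) :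
    coordChange g (coordChange g⁻¹ p) = p := by
  rw [← coordChange_mul, inv_mul_cancel, coordChange_one]

theorem coordChange_injective (g : GL (Fin n) K) : Function.Injective (coordChange g) :=
  Function.LeftInverse.injective (coordChange_inv_apply g)

theorem coordChange_surjective (g : GL (Fin n) K) : Function.Surjective (coordChange g) :=
  Function.RightInverse.surjective (coordChange_apply_inv g)

theorem isHomogeneous_coordChange (g : GL (Fin n) K) {p : MvPolynomial (Fin n) K} {d : ℕ}
    (hp : p.IsHomogeneous d) : (coordChange g p).IsHomogeneous d := by
  have := hp.aeval (fun i => ∑ j, C (g.val i j) * X j : Fin n → MvPolynomial (Fin n) K)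
    (n := 1) fun i => IsHomogeneous.sum _ _ _ fun j _ => isHomogeneous_C_mul_X _ _
  simpa [coordChange] using this

/-- The family `G` is arbitrary so that this applies both to all of GL_n and to a one-parameter
family of transvections. -/
theorem coeff_coordChange_mem {Y : Type*} (P : Subalgebra K (Y → K)) (G : Y → GL (Fin n) K)
    (hG : ∀ i j, (fun y => (G y).val i j) ∈ P) (w : MvPolynomial (Fin n) K) (u : Fin n →₀ ℕ) :
    (fun y => coeff u (coordChange (G y) w)) ∈ P := by
  classical
  induction w using MvPolynomial.induction_on generalizing u with
  | C a =>
    have : (fun y => coeff u (coordChange (G y) (C a))) =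
        algebraMap K (Y → K) (coeff u (C a)) := by
      ext y
      rw [MvPolynomial.algHom_C]
      rfl
    rw [this]
    exact Subalgebra.algebraMap_mem _ _
  | add p q hp hq =>
    simp only [map_add, coeff_add]
    exact Subalgebra.add_mem _ (hp u) (hq u)
  | mul_X p i hp =>
    have : (fun y => coeff u (coordChange (G y) (p * X i))) =
        ∑ x ∈ Finset.HasAntidiagonal.antidiagonal u, (fun y => coeff x.1 (coordChange (G y) p)) *
          ∑ j, coeff x.2 (X j : MvPolynomial (Fin n) K) • (fun y => (G y).val i j) := by
      ext y
      rw [map_mul, coordChange_X, coeff_mul]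
      simp only [Finset.sum_apply, Pi.mul_apply, coeff_sum,
        coeff_C_mul, Pi.smul_apply, smul_eq_mul, mul_comm (coeff _ (X _))]
    rw [this]
    exact Subalgebra.sum_mem _ fun x _ => Subalgebra.mul_mem _ (hp _)
      (Subalgebra.sum_mem _ fun j _ => Subalgebra.smul_mem _ (hG _ _) _)

/-- The image of a space of polynomials under a linear change of coordinates. -/
def transform (g : GL (Fin n) K) (V : Submodule K (MvPolynomial (Fin n) K)) :
    Submodule K (MvPolynomial (Fin n) K) :=
  V.map (coordChange g).toLinearMap

theorem mem_transform {g : GL (Fin n) K} {V : Submodule K (MvPolynomial (Fin n) K)}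
    {p : MvPolynomial (Fin n) K} : p ∈ transform g V ↔ ∃ q ∈ V, coordChange g q = p := by
  simp [transform]

theorem finrank_transform (g : GL (Fin n) K) (V : Submodule K (MvPolynomial (Fin n) K)) :
    Module.finrank K (transform g V) = Module.finrank K V :=
  (Submodule.equivMapOfInjective _ (coordChange_injective g) V).finrank_eq.symm

theorem transform_mul (g h : GL (Fin n) K) (V : Submodule K (MvPolynomial (Fin n) K)) :
    transform (h * g) V = transform g (transform h V) := by
  ext p
  simp [mem_transform, coordChange_mul]

/-! ### Ranks of coefficients and generic coordinates -/

/-- The coefficients at the exponents in `N`. -/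
def coeffMap (K : Type*) [Field K] {n : ℕ} (N : Finset (Fin n →₀ ℕ)) :
    MvPolynomial (Fin n) K →ₗ[K] (N → K) :=
  LinearMap.pi fun u => lcoeff K u.1

@[simp]
theorem coeffMap_apply (N : Finset (Fin n →₀ ℕ)) (p : MvPolynomial (Fin n) K) (u : N) :
    coeffMap K N p u = coeff u.1 p := rfl

/-- The rank of the coefficients at `N` on the space `W`. -/
def coeffRank (N : Finset (Fin n →₀ ℕ)) (W : Submodule K (MvPolynomial (Fin n) K)) : ℕ :=
  Module.finrank K (W.map (coeffMap K N))

theorem coeffRank_le_card (N : Finset (Fin n →₀ ℕ)) (W : Submodule K (MvPolynomial (Fin n) K)) :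
    coeffRank N W ≤ N.card := by
  refine (Submodule.finrank_le _).trans ?_
  simp

theorem exists_linearIndependent_coeffMap (N : Finset (Fin n →₀ ℕ))
    (W : Submodule K (MvPolynomial (Fin n) K)) :
    ∃ b : Fin (coeffRank N W) → MvPolynomial (Fin n) K, (∀ k, b k ∈ W) ∧
      LinearIndependent K (fun k => coeffMap K N (b k)) ∧
      Submodule.span K (Set.range fun k => coeffMap K N (b k)) = W.map (coeffMap K N) := by
  let B : Module.Basis (Fin (coeffRank N W)) K (W.map (coeffMap K N)) := Module.finBasis K _
  choose b hb hbB using fun k => Submodule.mem_map.1 (B k).2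
  refine ⟨b, hb, ?_, ?_⟩
  · have := B.linearIndependent.map' (Submodule.subtype _) (Submodule.ker_subtype _)
    rwa [show (fun k => coeffMap K N (b k)) = Submodule.subtype _ ∘ B from funext hbB]
  · have := congrArg (Submodule.map (Submodule.subtype _)) B.span_eq
    rw [Submodule.map_span, Submodule.map_top, Submodule.range_subtype, ← Set.range_comp] at this
    rwa [show (fun k => coeffMap K N (b k)) = Submodule.subtype _ ∘ B from funext hbB]

theorem card_le_coeffRank {ι : Type*} [Fintype ι] (N : Finset (Fin n →₀ ℕ))
    (W : Submodule K (MvPolynomial (Fin n) K)) (F : ι → N → K)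
    (hF : ∀ k, F k ∈ W.map (coeffMap K N)) (h : LinearIndependent K F) :
    Fintype.card ι ≤ coeffRank N W := by
  rw [← finrank_span_eq_card h]
  refine Submodule.finrank_mono (Submodule.span_le.2 ?_)
  rintro _ ⟨k, rfl⟩
  exact hF k

/-- `g` maximizes the rank of the coefficients at `N` on the space `g V`. -/
def IsRankGeneric (V : Submodule K (MvPolynomial (Fin n) K)) (N : Finset (Fin n →₀ ℕ))
    (g : GL (Fin n) K) : Prop :=
  ∀ h, coeffRank N (transform h V) ≤ coeffRank N (transform g V)

/-- The rank is bounded by the size of `N`, so a maximum is attained. Vectors independent at a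
maximizing point stay independent on an open set, so the maximum persists there. -/
theorem exists_isRankGeneric (V : Submodule K (MvPolynomial (Fin n) K))
    (N : Finset (Fin n →₀ ℕ)) :
    ∃ p ∈ glPolynomials K n, p ≠ 0 ∧ ∀ g, p g ≠ 0 → IsRankGeneric V N g := by
  obtain ⟨g₀, hg₀⟩ : ∃ g₀, IsRankGeneric V N g₀ := by
    have hbdd : BddAbove (Set.range fun g => coeffRank N (transform g V)) := by
      refine ⟨N.card, ?_⟩
      rintro _ ⟨g, rfl⟩
      exact coeffRank_le_card _ _
    obtain ⟨g₀, h⟩ := Nat.sSup_mem (Set.range_nonempty fun g => coeffRank N (transform g V)) hbdd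
    exact ⟨g₀, fun g => (le_csSup hbdd ⟨g, rfl⟩).trans h.ge⟩
  obtain ⟨b, hb, hind, -⟩ := exists_linearIndependent_coeffMap N (transform g₀ V)
  choose c hc hcb using fun k => mem_transform.1 (hb k)
  simp only [← hcb] at hind
  obtain ⟨p, hp, hp0, hpi⟩ := exists_mem_subalgebra_linearIndependent (glPolynomials K n)
    (fun g k => coeffMap K N (coordChange g (c k))) (fun k u =>
      coeff_coordChange_mem _ id entry_mem_glPolynomials _ _) g₀ hind
  refine ⟨p, hp, fun h => hp0 (congrFun h g₀), fun g hg h => (hg₀ h).trans ?_⟩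
  have := card_le_coeffRank N (transform g V) _ (fun k =>
    Submodule.mem_map_of_mem (mem_transform.2 ⟨c k, hc k, rfl⟩)) (hpi g hg)
  simpa using this

theorem exists_isRankGeneric_finset [Infinite K] (V : Submodule K (MvPolynomial (Fin n) K))
    (S : Finset (Finset (Fin n →₀ ℕ))) :
    ∃ p ∈ glPolynomials K n, p ≠ 0 ∧ ∀ g, p g ≠ 0 → ∀ N ∈ S, IsRankGeneric V N g := by
  choose p hp hp0 hpg using exists_isRankGeneric V
  refine ⟨∏ N ∈ S, p N, Subalgebra.prod_mem _ fun N _ => hp N,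
    prod_ne_zero_of_mem_glPolynomials _ _ (fun N _ => hp N) (fun N _ => hp0 N), ?_⟩
  intro g hg N hN
  rw [Finset.prod_apply] at hg
  exact hpg N g (Finset.prod_ne_zero_iff.1 hg N hN)

end CoordChange

/-! ### First-order deformation along transvections -/

/-- The polynomial functions on `K`. -/
def polyFunctions (K : Type*) [Field K] : Subalgebra K (K → K) :=
  (Polynomial.aeval (id : K → K)).range

theorem mem_polyFunctions {K : Type*} [Field K] {p : K → K} :
    p ∈ polyFunctions K ↔ ∃ q : Polynomial K, ∀ t, p t = q.eval t := by
  have key : ∀ (q : Polynomial K) (t : K), Polynomial.aeval (id : K → K) q t = q.eval t := by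
    intro q t
    induction q using Polynomial.induction_on' with
    | add p q hp hq => simp only [map_add, Pi.add_apply, hp, hq, Polynomial.eval_add]
    | monomial k a => simp [Polynomial.aeval_monomial]
  constructor
  · rintro ⟨q, rfl⟩
    exact ⟨q, key q⟩
  · rintro ⟨q, hq⟩
    refine ⟨q, ?_⟩
    funext t
    rw [hq]
    exact key q t

theorem exists_ne_zero_of_mem_polyFunctions {K : Type*} [Field K] [Infinite K] {p : K → K}
    (hp : p ∈ polyFunctions K) (h0 : p 0 ≠ 0) : ∃ t, t ≠ 0 ∧ p t ≠ 0 := by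
  obtain ⟨q, hq⟩ := mem_polyFunctions.1 hp
  by_contra! hcon
  have : q * Polynomial.X = 0 := Polynomial.funext fun t => by
    by_cases ht : t = 0
    · simp [ht]
    · simp [← hq, hcon t ht]
  have hq0 : q = 0 := by simpa using this
  exact h0 (by simp [hq, hq0])

section Transvection

variable {K : Type*} [Field K] {n : ℕ}

/-- The elementary matrix for the change of coordinates `x_j ↦ x_j + t x_i`. -/
def transvectionGL {i j : Fin n} (hij : i ≠ j) (t : K) : GL (Fin n) K :=
  Matrix.GeneralLinearGroup.mkOfDetNeZero (Matrix.transvection j i t)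
    (by simp [Matrix.det_transvection_of_ne _ _ hij.symm])

theorem transvectionGL_apply {i j : Fin n} (hij : i ≠ j) (t : K) (k l : Fin n) :
    (transvectionGL hij t).val k l =
      (1 : Matrix (Fin n) (Fin n) K) k l + t * (if j = k ∧ i = l then 1 else 0) := by
  change Matrix.transvection j i t k l = _
  simp [Matrix.transvection, Matrix.single_apply]

theorem transvectionGL_zero {i j : Fin n} (hij : i ≠ j) :
    transvectionGL hij (0 : K) = 1 := by
  ext k l
  rw [transvectionGL_apply]
  simp

theorem coordChange_transvectionGL_X {i j : Fin n} (hij : i ≠ j) (t : K) (k : Fin n) :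
    coordChange (transvectionGL hij t) (X k) =
      X k + C t * (X i * pderiv j (X k : MvPolynomial (Fin n) K)) := by
  rw [coordChange_X]
  simp only [transvectionGL_apply, map_add, map_mul, add_mul, Finset.sum_add_distrib]
  congr 1
  · simp [Matrix.one_apply, ite_mul, apply_ite]
  · by_cases hjk : j = k
    · subst hjk
      simp [apply_ite]
    · simp [hjk, pderiv_X_of_ne (Ne.symm hjk)]

/-- Taylor expansion in t, with x_i ∂_j as infinitesimal generator. The remainder is a polynomial
evaluated at `C t`, so its coefficients are polynomial functions of t. -/
theorem exists_coordChange_transvectionGL_eq {i j : Fin n} (hij : i ≠ j)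
    (w : MvPolynomial (Fin n) K) :
    ∃ R : Polynomial (MvPolynomial (Fin n) K), ∀ t,
      coordChange (transvectionGL hij t) w =
        w + C t * (X i * pderiv j w) + C t ^ 2 * R.eval (C t) := by
  induction w using MvPolynomial.induction_on with
  | C a => exact ⟨0, fun t => by simp⟩
  | add p q hp hq =>
    obtain ⟨R, hR⟩ := hp
    obtain ⟨S, hS⟩ := hq
    refine ⟨R + S, fun t => ?_⟩
    rw [map_add, hR, hS, map_add, Polynomial.eval_add]
    ring
  | mul_X p k hp =>
    obtain ⟨R, hR⟩ := hp
    refine ⟨R * Polynomial.C (X k) + Polynomial.C (X i * pderiv j p * (X i * pderiv j (X k))) +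
      Polynomial.X * R * Polynomial.C (X i * pderiv j (X k)), fun t => ?_⟩
    rw [map_mul, hR, coordChange_transvectionGL_X, Derivation.leibniz]
    simp only [Polynomial.eval_add, Polynomial.eval_mul, Polynomial.eval_C, Polynomial.eval_X,
      smul_eq_mul]
    ring

theorem coeff_eval_C_mem_polyFunctions (R : Polynomial (MvPolynomial (Fin n) K))
    (u : Fin n →₀ ℕ) : (fun t => coeff u (R.eval (C t))) ∈ polyFunctions K := by
  refine mem_polyFunctions.2 ⟨∑ k ∈ Finset.range (R.natDegree + 1),
    Polynomial.C (coeff u (R.coeff k)) * Polynomial.X ^ k, fun t => ?_⟩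
  rw [Polynomial.eval_eq_sum_range, coeff_sum, Polynomial.eval_finsetSum]
  refine Finset.sum_congr rfl fun k _ => ?_
  rw [← C_pow, mul_comm, coeff_C_mul, mul_comm]
  simp

/-- If the rank of the coefficients at `N` is maximal at `g`, then a vector `v` of `g V` whose
coefficients at `N` vanish deforms to first order. -/
theorem IsRankGeneric.exists_coeff_eq [Infinite K] {V : Submodule K (MvPolynomial (Fin n) K)}
    {N : Finset (Fin n →₀ ℕ)} {g : GL (Fin n) K} (hg : IsRankGeneric V N g)
    {v : MvPolynomial (Fin n) K} (hv : v ∈ transform g V) (hv0 : ∀ u ∈ N, coeff u v = 0)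
    {i j : Fin n} (hij : i ≠ j) :
    ∃ w ∈ transform g V, ∀ u ∈ N, coeff u w = coeff u (X i * pderiv j v) := by
  by_contra hcon
  obtain ⟨b, hb, hind, hspan⟩ := exists_linearIndependent_coeffMap N (transform g V)
  obtain ⟨R, hR⟩ := exists_coordChange_transvectionGL_eq hij v
  -- The entry `none` is the difference quotient of the deformation of `v`, extended to t = 0. If no
  -- suitable `w` exists, the family is independent at t = 0, hence at some t ≠ 0.
  let F : K → Option (Fin (coeffRank N (transform g V))) → N → K := fun t o =>
    o.elim (coeffMap K N (X i * pderiv j v + C t * R.eval (C t)))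
      fun k => coeffMap K N (coordChange (transvectionGL hij t) (b k))
  have hF0 : LinearIndependent K (F 0) := by
    rw [linearIndependent_option]
    have h1 : (F 0 ∘ fun k => some k) = fun k => coeffMap K N (b k) := by
      ext k u
      simp [F, transvectionGL_zero, coordChange_one]
    refine ⟨h1 ▸ hind, ?_⟩
    rw [h1, hspan]
    rintro ⟨w, hw, hwe⟩
    refine hcon ⟨w, hw, fun u hu => ?_⟩
    have := congrFun hwe ⟨u, hu⟩
    simpa [F] using this
  have hid : (fun t => t) ∈ polyFunctions K := mem_polyFunctions.2 ⟨Polynomial.X, by simp⟩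
  have hcst : ∀ a : K, (fun _ => a) ∈ polyFunctions K := fun a =>
    mem_polyFunctions.2 ⟨Polynomial.C a, by simp⟩
  have hFP : ∀ o u, (fun t => F t o u) ∈ polyFunctions K := by
    rintro (_ | k) u
    · have : (fun t => F t none u) = (fun _ => coeff u.1 (X i * pderiv j v)) +
          (fun t => t) * fun t => coeff u.1 (R.eval (C t)) := by
        ext t
        simp [F]
      rw [this]
      exact Subalgebra.add_mem _ (hcst _)
        (Subalgebra.mul_mem _ hid (coeff_eval_C_mem_polyFunctions _ _))
    · refine coeff_coordChange_mem _ (fun t => transvectionGL hij t) (fun k l => ?_) _ _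
      simp only [transvectionGL_apply]
      exact Subalgebra.add_mem _ (hcst _) (Subalgebra.mul_mem _ hid (hcst _))
  obtain ⟨p, hp, hp0, hpi⟩ := exists_mem_subalgebra_linearIndependent _ F hFP 0 hF0
  obtain ⟨t, ht, hpt⟩ := exists_ne_zero_of_mem_polyFunctions hp hp0
  -- For t ≠ 0 all members of the family are coefficient vectors of the deformed space, because `v`
  -- vanishes at `N`. The rank would exceed the maximum by one.
  have hle := card_le_coeffRank N (transform (g * transvectionGL hij t) V) (F t) ?_ (hpi t hpt)
  · have := hle.trans (hg _)
    simp at this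
  · rw [transform_mul]
    rintro (_ | k)
    · refine ⟨C t⁻¹ * coordChange (transvectionGL hij t) v, ?_, ?_⟩
      · rw [← smul_eq_C_mul]
        exact Submodule.smul_mem _ _ (mem_transform.2 ⟨v, hv, rfl⟩)
      · ext u
        have h1 : C t⁻¹ * coordChange (transvectionGL hij t) v =
            C t⁻¹ * v + (X i * pderiv j v + C t * R.eval (C t)) := by
          rw [hR]
          have : (C t⁻¹ : MvPolynomial (Fin n) K) * C t = 1 := by
            rw [← C_mul, inv_mul_cancel₀ ht, C_1]
          linear_combination (X i * pderiv j v + C t * R.eval (C t)) * this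
        rw [h1, map_add]
        simp [F, hv0 u.1 u.2]
    · exact Submodule.mem_map_of_mem (mem_transform.2 ⟨b k, hb k, rfl⟩)

end Transvection

/-! ### Leading exponents and strong stability -/

section LeadExps

open scoped MonomialOrder

variable {K : Type*} [Field K] {n : ℕ}

theorem revlex_add_lt_add_iff {a b : Fin n →₀ ℕ} (c : Fin n →₀ ℕ) :
    a + c ≺[revlex n] b + c ↔ a ≺[revlex n] b := by
  simp

theorem revlex_lt_iff {a b : Fin n →₀ ℕ} :
    a ≺[revlex n] b ↔ a.degree < b.degree ∨
      (a.degree = b.degree ∧ ∃ i, b i < a i ∧ ∀ j, i < j → a j = b j) :=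
  RevlexExp.lt_iff

/-- `u` is the exponent of the leading monomial of `v`. -/
def IsLeadExp (v : MvPolynomial (Fin n) K) (u : Fin n →₀ ℕ) : Prop :=
  coeff u v ≠ 0 ∧ ∀ z, u ≺[revlex n] z → coeff z v = 0

/-- The exponents of the leading monomials of the nonzero elements of `W`. -/
def leadExps (W : Submodule K (MvPolynomial (Fin n) K)) : Set (Fin n →₀ ℕ) :=
  {u | ∃ v ∈ W, IsLeadExp v u}

theorem isLeadExp_degree {v : MvPolynomial (Fin n) K} (hv : v ≠ 0) :
    IsLeadExp v ((revlex n).degree v) :=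
  ⟨(revlex n).coeff_degree_ne_zero_iff.2 hv, fun _ hz => (revlex n).coeff_eq_zero_of_lt hz⟩

theorem IsLeadExp.ne_zero {v : MvPolynomial (Fin n) K} {u : Fin n →₀ ℕ} (h : IsLeadExp v u) :
    v ≠ 0 := by
  rintro rfl
  exact h.1 (by simp)

theorem IsLeadExp.eq {v : MvPolynomial (Fin n) K} {u u' : Fin n →₀ ℕ} (h : IsLeadExp v u)
    (h' : IsLeadExp v u') : u = u' := by
  rcases lt_trichotomy ((revlex n).toSyn u) ((revlex n).toSyn u') with hlt | heq | hlt
  · exact absurd (h.2 _ hlt) h'.1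
  · exact (revlex n).toSyn.injective heq
  · exact absurd (h'.2 _ hlt) h.1

/-- The operator moves the monomial z + e_j to z + e_i with the factor z_j + 1, nonzero in
characteristic zero, and kills monomials without x_j. Translation preserves the order. -/
theorem isLeadExp_X_mul_pderiv [CharZero K] {v : MvPolynomial (Fin n) K} {c : Fin n →₀ ℕ}
    {i j : Fin n} (hv : IsLeadExp v (c + Finsupp.single j 1)) :
    IsLeadExp (X i * pderiv j v) (c + Finsupp.single i 1) := by
  classical
  have hcoeff : ∀ z : Fin n →₀ ℕ, coeff (z + Finsupp.single i 1) (X i * pderiv j v) =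
      coeff (z + Finsupp.single j 1) v * (z j + 1) := fun z => by
    rw [coeff_X_mul', if_pos (by simp), add_tsub_cancel_right, coeff_pderiv]
  refine ⟨?_, fun z hz => ?_⟩
  · rw [hcoeff]
    exact mul_ne_zero hv.1 (Nat.cast_add_one_ne_zero _)
  · by_cases hzi : z i = 0
    · rw [coeff_X_mul', if_neg (by simpa using hzi)]
    · obtain ⟨y, rfl⟩ : ∃ y, z = y + Finsupp.single i 1 :=
        ⟨z - Finsupp.single i 1, (tsub_add_cancel_of_le (by
          rw [Finsupp.single_le_iff]; omega)).symm⟩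
      rw [revlex_add_lt_add_iff] at hz
      rw [hcoeff, hv.2 _ ((revlex_add_lt_add_iff _).2 hz), zero_mul]

/-- Since `N` is an upper set in degree `d`, agreement on `N` controls every coefficient from the
new leading exponent upwards. -/
theorem IsRankGeneric.exists_isLeadExp [CharZero K] {V : Submodule K (MvPolynomial (Fin n) K)}
    {d : ℕ} (hV : V ≤ homogeneousSubmodule (Fin n) K d)
    {N : Finset (Fin n →₀ ℕ)} {g : GL (Fin n) K} (hg : IsRankGeneric V N g)
    (hN : ∀ z ∈ N, ∀ z', z'.degree = d → z ≺[revlex n] z' → z' ∈ N)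
    {v : MvPolynomial (Fin n) K} (hv : v ∈ transform g V) (hv0 : ∀ u ∈ N, coeff u v = 0)
    {i j : Fin n} (hij : i ≠ j) {c : Fin n →₀ ℕ} (hvc : IsLeadExp v (c + Finsupp.single j 1))
    (hc : c + Finsupp.single i 1 ∈ N) :
    ∃ w ∈ transform g V, IsLeadExp w (c + Finsupp.single i 1) ∧
      ∀ u ∈ N, coeff u w = coeff u (X i * pderiv j v) := by
  have : Infinite K := .of_injective _ Nat.cast_injective
  obtain ⟨w, hw, hwe⟩ := hg.exists_coeff_eq hv hv0 hij
  have hlead := isLeadExp_X_mul_pderiv (i := i) hvc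
  refine ⟨w, hw, ⟨by rw [hwe _ hc]; exact hlead.1, fun z hz => ?_⟩, hwe⟩
  by_cases hzd : z.degree = d
  · rw [hwe z (hN _ hc z hzd hz), hlead.2 z hz]
  · obtain ⟨q, hq, rfl⟩ := mem_transform.1 hw
    exact (isHomogeneous_coordChange g (hV hq)).coeff_eq_zero hzd

/-- The exponents of degree `d`. -/
def degreeExps (n d : ℕ) : Finset (Fin n →₀ ℕ) := Finset.univ.finsuppAntidiag d

@[simp]
theorem mem_degreeExps {d : ℕ} {u : Fin n →₀ ℕ} : u ∈ degreeExps n d ↔ u.degree = d := by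
  simp [degreeExps, Finset.mem_finsuppAntidiag, Finsupp.degree_eq_sum]

/-- `g` is generic for all sets of exponents of degree `d`. -/
def IsGenericInDegree (V : Submodule K (MvPolynomial (Fin n) K)) (d : ℕ) (g : GL (Fin n) K) :
    Prop :=
  ∀ N ⊆ degreeExps n d, IsRankGeneric V N g

theorem exists_isGenericInDegree [Infinite K] (V : Submodule K (MvPolynomial (Fin n) K))
    (d : ℕ) : ∃ p ∈ glPolynomials K n, p ≠ 0 ∧ ∀ g, p g ≠ 0 → IsGenericInDegree V d g := by
  obtain ⟨p, hp, hp0, h⟩ := exists_isRankGeneric_finset V (degreeExps n d).powerset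
  exact ⟨p, hp, hp0, fun g hg N hN => h g hg N (Finset.mem_powerset.2 hN)⟩

theorem degree_eq_of_mem_leadExps {W : Submodule K (MvPolynomial (Fin n) K)} {d : ℕ}
    (hW : W ≤ homogeneousSubmodule (Fin n) K d) {u : Fin n →₀ ℕ} (hu : u ∈ leadExps W) :
    u.degree = d := by
  obtain ⟨v, hv, hvu⟩ := hu
  by_contra h
  exact hvu.1 (IsHomogeneous.coeff_eq_zero (hW hv) h)

theorem transform_le_homogeneousSubmodule {V : Submodule K (MvPolynomial (Fin n) K)} {d : ℕ}
    (hV : V ≤ homogeneousSubmodule (Fin n) K d) (g : GL (Fin n) K) :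
    transform g V ≤ homogeneousSubmodule (Fin n) K d := by
  intro p hp
  obtain ⟨q, hq, rfl⟩ := mem_transform.1 hp
  exact isHomogeneous_coordChange g (hV hq)

/-- The leading exponents in generic coordinates are strongly stable. -/
theorem IsGenericInDegree.add_single_mem_leadExps [CharZero K]
    {V : Submodule K (MvPolynomial (Fin n) K)} {d : ℕ}
    (hV : V ≤ homogeneousSubmodule (Fin n) K d) {g : GL (Fin n) K}
    (hg : IsGenericInDegree V d g) {i j : Fin n} (hij : i < j) {c : Fin n →₀ ℕ}
    (hc : c + Finsupp.single j 1 ∈ leadExps (transform g V)) :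
    c + Finsupp.single i 1 ∈ leadExps (transform g V) := by
  classical
  have hdeg := degree_eq_of_mem_leadExps (transform_le_homogeneousSubmodule hV g) hc
  obtain ⟨v, hv, hvc⟩ := hc
  have hlt : c + Finsupp.single j 1 ≺[revlex n] c + Finsupp.single i 1 := by
    rw [revlex_lt_iff]
    refine Or.inr ⟨by simp, j, by simp [hij.ne], fun k hk => ?_⟩
    simp [hk.ne, (hij.trans hk).ne]
  have hdeg' : (c + Finsupp.single i 1).degree = d := by
    rw [← hdeg]
    simp
  -- Here `N` consists of the exponents from c + e_i upwards; `v` vanishes on it because its leading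
  -- exponent c + e_j is smaller.
  obtain ⟨w, hw, hwl, -⟩ := (hg ((degreeExps n d).filter fun z =>
      c + Finsupp.single i 1 ≼[revlex n] z) (Finset.filter_subset _ _)).exists_isLeadExp hV
    (fun z hz z' hz' hzz' => by
      rw [Finset.mem_filter] at hz ⊢
      exact ⟨by simpa using hz', hz.2.trans hzz'.le⟩) hv
    (fun z hz => hvc.2 z (hlt.trans_le (Finset.mem_filter.1 hz).2)) hij.ne hvc (by
      rw [Finset.mem_filter]
      exact ⟨by simpa using hdeg', le_rfl⟩)
  exact ⟨w, hw, hwl⟩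

end LeadExps

/-! ### Initial ideals and existence of the generic initial ideal -/

section InitialIdeal

open scoped MonomialOrder

variable {K : Type*} [Field K] {n : ℕ}

theorem linearIndependent_of_isLeadExp {ι : Type*} (v : ι → MvPolynomial (Fin n) K)
    (e : ι → Fin n →₀ ℕ) (he : Function.Injective e) (h : ∀ k, IsLeadExp (v k) (e k)) :
    LinearIndependent K v := by
  classical
  rw [linearIndependent_iff']
  intro s c hsum
  by_contra! hcon
  obtain ⟨k, hk, hck⟩ := hcon
  obtain ⟨m, hm, hmax⟩ := Finset.exists_max_image (s.filter fun k => c k ≠ 0)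
    (fun k => (revlex n).toSyn (e k)) ⟨k, by simp [hk, hck]⟩
  rw [Finset.mem_filter] at hm
  have := congrArg (coeff (e m)) hsum
  rw [coeff_sum, Finset.sum_eq_single_of_mem m hm.1] at this
  · rw [coeff_smul, smul_eq_mul, coeff_zero, mul_eq_zero] at this
    exact this.elim hm.2 (h m).1
  · intro l hl hlm
    by_cases hcl : c l = 0
    · simp [hcl]
    · have hle := hmax l (by simp [hl, hcl])
      have hlt := lt_of_le_of_ne hle fun heq => hlm (he ((revlex n).toSyn.injective heq))
      rw [coeff_smul, (h l).2 _ hlt, smul_zero]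

theorem finite_of_le_homogeneousSubmodule {W : Submodule K (MvPolynomial (Fin n) K)} {d : ℕ}
    (hW : W ≤ homogeneousSubmodule (Fin n) K d) : Module.Finite K W := by
  have : Module.Finite K (homogeneousSubmodule (Fin n) K d) :=
    Module.Finite.iff_fg.2 (homogeneousSubmodule_fg _ _ d)
  exact Module.Finite.of_injective _ (Submodule.inclusion_injective hW)

theorem finite_leadExps {W : Submodule K (MvPolynomial (Fin n) K)} {d : ℕ}
    (hW : W ≤ homogeneousSubmodule (Fin n) K d) : (leadExps W).Finite :=
  (degreeExps n d).finite_toSet.subset fun _ hu => by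
    simpa using degree_eq_of_mem_leadExps hW hu

/-- A space of forms has as many leading monomials as its dimension. -/
theorem ncard_leadExps {W : Submodule K (MvPolynomial (Fin n) K)} {d : ℕ}
    (hW : W ≤ homogeneousSubmodule (Fin n) K d) :
    (leadExps W).ncard = Module.finrank K W := by
  have := finite_of_le_homogeneousSubmodule hW
  have hfin := finite_leadExps hW
  rw [Set.ncard_eq_toFinset_card _ hfin]
  refine le_antisymm ?_ ?_
  · choose v hvW hv using fun u : hfin.toFinset => hfin.mem_toFinset.1 u.2
    have hind : LinearIndependent K fun u => (⟨v u, hvW u⟩ : W) :=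
      LinearIndependent.of_comp W.subtype
        (linearIndependent_of_isLeadExp v (fun u => u.1) Subtype.val_injective hv)
    simpa using hind.fintype_card_le_finrank
  -- A nonzero element has a nonzero coefficient at its own leading exponent, so the coefficients at
  -- `leadExps W` determine an element of `W`.
  · have hinj : Function.Injective ((coeffMap K hfin.toFinset).domRestrict W) := by
      rw [← LinearMap.ker_eq_bot, LinearMap.ker_eq_bot']
      rintro ⟨v, hv⟩ h0
      by_contra hne
      have hlead := isLeadExp_degree (n := n) (v := v) fun h => hne (Subtype.ext h)
      have := congrFun h0 ⟨_, hfin.mem_toFinset.2 ⟨v, hv, hlead⟩⟩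
      exact hlead.1 this
    simpa using LinearMap.finrank_le_finrank_of_injective hinj

/-- The rank jumps at `u` exactly when some element vanishes above `u` but not at `u`. Hence the
leading exponents depend only on coefficient ranks. -/
theorem mem_leadExps_iff_coeffRank_ne {W : Submodule K (MvPolynomial (Fin n) K)} {d : ℕ}
    (hW : W ≤ homogeneousSubmodule (Fin n) K d) {u : Fin n →₀ ℕ} (hu : u.degree = d) :
    u ∈ leadExps W ↔ coeffRank ((degreeExps n d).filter fun z => u ≼[revlex n] z) W ≠
      coeffRank ((degreeExps n d).filter fun z => u ≺[revlex n] z) W := by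
  have := finite_of_le_homogeneousSubmodule hW
  set N₁ := (degreeExps n d).filter fun z => u ≼[revlex n] z with hN₁
  set N₂ := (degreeExps n d).filter fun z => u ≺[revlex n] z with hN₂
  have hrank : ∀ N : Finset (Fin n →₀ ℕ), coeffRank N W +
      Module.finrank K (LinearMap.ker ((coeffMap K N).domRestrict W)) = Module.finrank K W :=
    fun N => by
      rw [← LinearMap.finrank_range_add_finrank_ker ((coeffMap K N).domRestrict W),
        LinearMap.range_domRestrict]
      rfl
  have hker : ∀ (N : Finset (Fin n →₀ ℕ)) (v : W),
      v ∈ LinearMap.ker ((coeffMap K N).domRestrict W) ↔ ∀ z ∈ N, coeff z v.1 = 0 := fun N v =>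
    ⟨fun h z hz => congrFun h ⟨z, hz⟩, fun h => funext fun z => h z.1 z.2⟩
  have hle : LinearMap.ker ((coeffMap K N₁).domRestrict W) ≤
      LinearMap.ker ((coeffMap K N₂).domRestrict W) := fun v hv => by
    rw [hker] at hv ⊢
    intro z hz
    rw [hN₂, Finset.mem_filter] at hz
    exact hv z (by rw [hN₁, Finset.mem_filter]; exact ⟨hz.1, hz.2.le⟩)
  have hiff : coeffRank N₁ W = coeffRank N₂ W ↔
      LinearMap.ker ((coeffMap K N₁).domRestrict W) =
        LinearMap.ker ((coeffMap K N₂).domRestrict W) := by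
    refine ⟨fun h => Submodule.eq_of_le_of_finrank_eq hle ?_, fun h => ?_⟩
    · have h1 := hrank N₁
      have h2 := hrank N₂
      omega
    · have h1 := hrank N₁
      have h2 := hrank N₂
      rw [h] at h1
      omega
  rw [Ne, hiff]
  constructor
  · rintro ⟨v, hv, hvu⟩ heq
    have : (⟨v, hv⟩ : W) ∈ LinearMap.ker ((coeffMap K N₂).domRestrict W) := by
      rw [hker]
      intro z hz
      exact hvu.2 z (Finset.mem_filter.1 hz).2
    rw [← heq, hker] at this
    exact hvu.1 (this u (by rw [hN₁, Finset.mem_filter]; exact ⟨by simpa using hu, le_rfl⟩))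
  · intro hne
    obtain ⟨v, hv2, hv1⟩ := SetLike.exists_of_lt (lt_of_le_of_ne hle hne)
    rw [hker] at hv1 hv2
    push Not at hv1
    obtain ⟨z, hz, hz0⟩ := hv1
    rw [hN₁, Finset.mem_filter] at hz
    have hzu : z = u := by
      by_contra hzu
      refine hz0 (hv2 z ?_)
      rw [hN₂, Finset.mem_filter]
      exact ⟨hz.1, lt_of_le_of_ne hz.2 fun h => hzu ((revlex n).toSyn.injective h).symm⟩
    subst hzu
    refine ⟨v.1, v.2, hz0, fun y hy => ?_⟩
    by_cases hyd : y.degree = d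
    · exact hv2 y (by rw [hN₂, Finset.mem_filter]; exact ⟨by simpa using hyd, hy⟩)
    · exact IsHomogeneous.coeff_eq_zero (hW v.2) hyd

theorem IsGenericInDegree.leadExps_transform_eq {V : Submodule K (MvPolynomial (Fin n) K)} {d : ℕ}
    (hV : V ≤ homogeneousSubmodule (Fin n) K d) {g h : GL (Fin n) K}
    (hg : IsGenericInDegree V d g) (hh : IsGenericInDegree V d h) :
    leadExps (transform g V) = leadExps (transform h V) := by
  have hrank : ∀ N ⊆ degreeExps n d, coeffRank N (transform g V) = coeffRank N (transform h V) :=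
    fun N hN => le_antisymm (hh N hN g) (hg N hN h)
  have hg' := transform_le_homogeneousSubmodule hV g
  have hh' := transform_le_homogeneousSubmodule hV h
  ext u
  by_cases hu : u.degree = d
  · rw [mem_leadExps_iff_coeffRank_ne hg' hu, mem_leadExps_iff_coeffRank_ne hh' hu,
      hrank _ (Finset.filter_subset _ _), hrank _ (Finset.filter_subset _ _)]
  · exact iff_of_false (fun h => hu (degree_eq_of_mem_leadExps hg' h))
      fun h => hu (degree_eq_of_mem_leadExps hh' h)

/-- The forms of degree `k` in the ideal `I`. -/
def homogPart (I : Ideal (MvPolynomial (Fin n) K)) (k : ℕ) :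
    Submodule K (MvPolynomial (Fin n) K) :=
  I.restrictScalars K ⊓ homogeneousSubmodule (Fin n) K k

theorem homogPart_le (I : Ideal (MvPolynomial (Fin n) K)) (k : ℕ) :
    homogPart I k ≤ homogeneousSubmodule (Fin n) K k := inf_le_right

theorem initialIdeal_eq (I : Ideal (MvPolynomial (Fin n) K)) :
    initialIdeal I =
      Ideal.span ((fun u => monomial u (1 : K)) '' leadExps (I.restrictScalars K)) := by
  rw [initialIdeal, MonomialOrder.span_leadingTerm_eq_span_monomial']
  congr 1
  ext q
  constructor
  · rintro ⟨p, ⟨hp, hp0⟩, rfl⟩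
    exact ⟨_, ⟨p, hp, isLeadExp_degree hp0⟩, rfl⟩
  · rintro ⟨u, ⟨p, hp, hpu⟩, rfl⟩
    exact ⟨p, ⟨hp, hpu.ne_zero⟩, by rw [hpu.eq (isLeadExp_degree hpu.ne_zero)]⟩

/-- Leading exponents of an ideal are closed under adding exponents, so passing to the generated
monomial ideal adds no monomials. -/
theorem monomial_mem_initialIdeal_iff {I : Ideal (MvPolynomial (Fin n) K)} {u : Fin n →₀ ℕ} :
    monomial u (1 : K) ∈ initialIdeal I ↔ u ∈ leadExps (I.restrictScalars K) := by
  classical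
  rw [initialIdeal_eq]
  refine ⟨fun h => ?_, fun h => Ideal.subset_span ⟨u, h, rfl⟩⟩
  rw [mem_ideal_span_monomial_image] at h
  obtain ⟨s, ⟨v, hv, hvs⟩, hsu⟩ := h u (by simp [mem_support_iff])
  refine ⟨monomial (u - s) 1 * v, I.mul_mem_left _ hv, ?_, fun z hz => ?_⟩
  · rw [coeff_monomial_mul', if_pos tsub_le_self, tsub_tsub_cancel_of_le hsu, one_mul]
    exact hvs.1
  · rw [coeff_monomial_mul']
    split_ifs with hle
    · rw [one_mul]
      refine hvs.2 _ ?_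
      rw [← revlex_add_lt_add_iff (u - s), tsub_add_cancel_of_le hle, add_tsub_cancel_of_le hsu]
      exact hz
    · rfl

/-- `I` contains the homogeneous components of its elements. -/
def HasComponents (I : Ideal (MvPolynomial (Fin n) K)) : Prop :=
  ∀ p ∈ I, ∀ k, homogeneousComponent k p ∈ I

theorem HasComponents.mem_leadExps_homogPart_iff {I : Ideal (MvPolynomial (Fin n) K)}
    (hI : HasComponents I) {k : ℕ} {u : Fin n →₀ ℕ} :
    u ∈ leadExps (homogPart I k) ↔ u.degree = k ∧ u ∈ leadExps (I.restrictScalars K) := by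
  constructor
  · intro h
    refine ⟨degree_eq_of_mem_leadExps (homogPart_le I k) h, ?_⟩
    obtain ⟨v, hv, hvu⟩ := h
    exact ⟨v, hv.1, hvu⟩
  · rintro ⟨rfl, v, hv, hvu⟩
    refine ⟨homogeneousComponent u.degree v, ⟨hI v hv _, homogeneousComponent_mem _ _⟩, ?_, ?_⟩
    · rw [coeff_homogeneousComponent, if_pos rfl]
      exact hvu.1
    · intro z hz
      rw [coeff_homogeneousComponent, hvu.2 z hz, ite_self]

theorem HasComponents.monomialsOfDegree_initialIdeal {I : Ideal (MvPolynomial (Fin n) K)}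
    (hI : HasComponents I) (k : ℕ) :
    monomialsOfDegree (initialIdeal I) k = leadExps (homogPart I k) := by
  ext u
  rw [hI.mem_leadExps_homogPart_iff, ← monomial_mem_initialIdeal_iff]
  rfl

theorem homogeneousComponent_coordChange (g : GL (Fin n) K) (k : ℕ)
    (p : MvPolynomial (Fin n) K) :
    homogeneousComponent k (coordChange g p) = coordChange g (homogeneousComponent k p) := by
  classical
  conv_lhs => rw [← sum_homogeneousComponent p]
  rw [map_sum, map_sum]
  rw [Finset.sum_congr rfl fun i _ => homogeneousComponent_of_mem
    (isHomogeneous_coordChange g (homogeneousComponent_isHomogeneous i p))]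
  rw [Finset.sum_ite_eq]
  split_ifs with h
  · rfl
  · rw [homogeneousComponent_eq_zero _ _ (by simpa using h), map_zero]

theorem mem_map_coordChange {I : Ideal (MvPolynomial (Fin n) K)} {g : GL (Fin n) K}
    {p : MvPolynomial (Fin n) K} :
    p ∈ I.map (coordChange g) ↔ ∃ q ∈ I, coordChange g q = p :=
  Ideal.mem_map_iff_of_surjective _ (coordChange_surjective g)

theorem HasComponents.map_coordChange {I : Ideal (MvPolynomial (Fin n) K)}
    (hI : HasComponents I) (g : GL (Fin n) K) : HasComponents (I.map (coordChange g)) := by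
  intro p hp k
  obtain ⟨q, hq, rfl⟩ := mem_map_coordChange.1 hp
  rw [homogeneousComponent_coordChange]
  exact mem_map_coordChange.2 ⟨_, hI q hq k, rfl⟩

theorem homogPart_map_coordChange (I : Ideal (MvPolynomial (Fin n) K)) (g : GL (Fin n) K)
    (k : ℕ) : homogPart (I.map (coordChange g)) k = transform g (homogPart I k) := by
  ext p
  rw [mem_transform]
  constructor
  · rintro ⟨hp, hpk⟩
    obtain ⟨q, hq, rfl⟩ := mem_map_coordChange.1 hp
    refine ⟨q, ⟨hq, ?_⟩, rfl⟩
    have := isHomogeneous_coordChange g⁻¹ hpk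
    rwa [coordChange_inv_apply] at this
  · rintro ⟨q, hq, rfl⟩
    exact ⟨mem_map_coordChange.2 ⟨q, hq.1, rfl⟩, isHomogeneous_coordChange g hq.2⟩

theorem isZariskiOpen_ne_zero {p : GL (Fin n) K → K} (hp : p ∈ glPolynomials K n) :
    IsZariskiOpen {g | p g ≠ 0} := by
  obtain ⟨q, hq⟩ := mem_glPolynomials.1 hp
  exact ⟨{q}, by simp [hq]⟩

/-- A homogeneous ideal has a generic initial ideal. -/
theorem HasComponents.exists_isGin [Infinite K] {I : Ideal (MvPolynomial (Fin n) K)}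
    (hI : HasComponents I) : ∃ J, IsGin I J := by
  choose p hp hp0 hpg using fun k => exists_isGenericInDegree (homogPart I k) k
  choose g₀ hg₀ using fun k => Function.ne_iff.1 (hp0 k)
  let A : ℕ → Set (Fin n →₀ ℕ) := fun k => leadExps (transform (g₀ k) (homogPart I k))
  have hA : ∀ k, ∀ u ∈ A k, u.degree = k := fun k u hu =>
    degree_eq_of_mem_leadExps (transform_le_homogeneousSubmodule (homogPart_le I k) _) hu
  let J : Ideal (MvPolynomial (Fin n) K) :=
    Ideal.span ((fun u => monomial u (1 : K)) '' ⋃ k, A k)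
  -- Finitely many generators bound the degrees in which genericity must be imposed, so a finite
  -- product defines the open set.
  obtain ⟨T, hTS, hTJ⟩ := (Submodule.fg_span_iff_fg_span_finset_subset _).1
    (IsNoetherian.noetherian J)
  let D := T.sup totalDegree
  refine ⟨J, {g | (∏ k ∈ Finset.range (D + 1), p k) g ≠ 0},
    isZariskiOpen_ne_zero (Subalgebra.prod_mem _ fun k _ => hp k),
    Function.ne_iff.1 (prod_ne_zero_of_mem_glPolynomials _ _ (fun k _ => hp k) fun k _ => hp0 k),
    fun g hg => ?_⟩
  have hgA : ∀ k ≤ D, leadExps (transform g (homogPart I k)) = A k := fun k hk => by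
    rw [Set.mem_ofPred_eq, Finset.prod_apply] at hg
    exact (hpg k g (Finset.prod_ne_zero_iff.1 hg k (by simpa [Nat.lt_succ_iff] using hk))
      ).leadExps_transform_eq (homogPart_le I k) (hpg k _ (hg₀ k))
  have hgI := hI.map_coordChange g
  have hle : J ≤ initialIdeal (I.map (coordChange g)) := by
    refine le_trans hTJ.le (Submodule.span_le.2 fun t ht => ?_)
    obtain ⟨u, hu, rfl⟩ := hTS ht
    obtain ⟨k, hk⟩ := Set.mem_iUnion.1 hu
    have hkD : k ≤ D := by
      have : totalDegree (monomial u (1 : K)) ≤ D := Finset.le_sup (f := totalDegree) ht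
      rwa [totalDegree_monomial _ one_ne_zero, Finsupp.sum, ← Finsupp.degree_apply,
        hA k u hk] at this
    rw [← hgA k hkD, ← homogPart_map_coordChange, hgI.mem_leadExps_homogPart_iff] at hk
    exact monomial_mem_initialIdeal_iff.2 hk.2
  refine le_antisymm ?_ hle
  rw [initialIdeal_eq]
  refine Ideal.span_mono (Set.image_mono fun u hu => Set.mem_iUnion.2 ⟨u.degree, ?_⟩)
  have hu' := hgI.mem_leadExps_homogPart_iff.2 ⟨rfl, hu⟩
  rw [homogPart_map_coordChange] at hu'
  -- In degrees beyond `D` only an inclusion is known, but both sets have the cardinality dim I_k,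
  -- so they agree.
  have hsub : A u.degree ⊆ leadExps (transform g (homogPart I u.degree)) := fun z hz => by
    rw [← homogPart_map_coordChange, hgI.mem_leadExps_homogPart_iff]
    exact ⟨hA _ z hz, monomial_mem_initialIdeal_iff.1
      (hle (Ideal.subset_span ⟨z, Set.mem_iUnion.2 ⟨_, hz⟩, rfl⟩))⟩
  have hW := transform_le_homogeneousSubmodule (homogPart_le I u.degree) g
  have hW₀ := transform_le_homogeneousSubmodule (homogPart_le I u.degree) (g₀ u.degree)
  have := Set.eq_of_subset_of_ncard_le hsub (by
    rw [ncard_leadExps hW, ncard_leadExps hW₀, finrank_transform, finrank_transform])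
    (finite_leadExps hW)
  rwa [this]

theorem homogeneousComponent_mul_of_isHomogeneous {f : MvPolynomial (Fin n) K} {d : ℕ}
    (hf : f.IsHomogeneous d) (a : MvPolynomial (Fin n) K) (k : ℕ) :
    homogeneousComponent (k + d) (a * f) = homogeneousComponent k a * f := by
  classical
  conv_lhs => rw [← sum_homogeneousComponent a]
  rw [Finset.sum_mul, map_sum]
  rw [Finset.sum_congr rfl fun i _ => homogeneousComponent_of_mem
    ((homogeneousComponent_isHomogeneous i a).mul hf)]
  simp only [add_left_inj]
  rw [Finset.sum_ite_eq]
  split_ifs with h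
  · rfl
  · rw [homogeneousComponent_eq_zero _ _ (by simpa using h), zero_mul]

theorem homogeneousComponent_mul_of_lt {f : MvPolynomial (Fin n) K} {d : ℕ}
    (hf : f.IsHomogeneous d) (a : MvPolynomial (Fin n) K) {k : ℕ} (hk : k < d) :
    homogeneousComponent k (a * f) = 0 := by
  classical
  conv_lhs => rw [← sum_homogeneousComponent a]
  rw [Finset.sum_mul, map_sum]
  refine Finset.sum_eq_zero fun i _ => ?_
  rw [homogeneousComponent_of_mem ((homogeneousComponent_isHomogeneous i a).mul hf),
    if_neg (by omega)]

theorem hasComponents_span_range {ι : Type*} [Fintype ι] {f : ι → MvPolynomial (Fin n) K}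
    {d : ℕ} (hf : ∀ i, (f i).IsHomogeneous d) : HasComponents (Ideal.span (Set.range f)) := by
  intro p hp k
  obtain ⟨c, rfl⟩ := (Ideal.mem_span_range_iff_exists_fun).1 hp
  rw [map_sum]
  refine Ideal.sum_mem _ fun i _ => ?_
  rcases lt_or_ge k d with hk | hk
  · rw [homogeneousComponent_mul_of_lt (hf i) _ hk]
    exact Ideal.zero_mem _
  · obtain ⟨l, rfl⟩ := Nat.exists_eq_add_of_le' hk
    rw [homogeneousComponent_mul_of_isHomogeneous (hf i)]
    exact Ideal.mul_mem_left _ _ (Ideal.subset_span ⟨i, rfl⟩)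

theorem homogPart_span_range {ι : Type*} [Fintype ι] {f : ι → MvPolynomial (Fin n) K}
    {d : ℕ} (hf : ∀ i, (f i).IsHomogeneous d) :
    homogPart (Ideal.span (Set.range f)) d = Submodule.span K (Set.range f) := by
  refine le_antisymm ?_ (Submodule.span_le.2 ?_)
  · rintro p ⟨hp, hpd⟩
    obtain ⟨c, rfl⟩ := (Ideal.mem_span_range_iff_exists_fun).1 hp
    rw [← homogeneousComponent_eq_self hpd, map_sum]
    refine Submodule.sum_mem _ fun i _ => ?_
    have := homogeneousComponent_mul_of_isHomogeneous (hf i) (c i) 0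
    rw [zero_add] at this
    rw [this, homogeneousComponent_zero, ← smul_eq_C_mul]
    exact Submodule.smul_mem _ _ (Submodule.subset_span ⟨i, rfl⟩)
  · rintro _ ⟨i, rfl⟩
    exact ⟨Ideal.subset_span ⟨i, rfl⟩, hf i⟩

end InitialIdeal

/-! ### Regular sequences: common zeros and linear independence -/

section RegularSequence

open RingTheory.Sequence

/-- Dividing by a weakly regular sequence lowers the dimension by at least its length. -/
theorem supportDim_quotient_add_length_le {R M : Type*} [CommRing R] [AddCommGroup M]
    [Module R M] [Module.Finite R M] (rs : List R) (reg : IsWeaklyRegular M rs) :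
    Module.supportDim R (M ⧸ Ideal.ofList rs • (⊤ : Submodule R M)) + rs.length ≤
      Module.supportDim R M := by
  induction rs generalizing M with
  | nil =>
    rw [Ideal.ofList_nil, Submodule.bot_smul]
    simpa using (Module.supportDim_eq_of_equiv (Submodule.quotEquivOfEqBot ⊥ rfl)).le
  | cons x rs' ih =>
    have h := (isWeaklyRegular_cons_iff M _ _).1 reg
    rw [Module.supportDim_eq_of_equiv
      (Submodule.quotOfListConsSMulTopEquivQuotSMulTopInner M x rs'), List.length_cons,
      Nat.cast_add, Nat.cast_one, ← add_assoc]
    exact (add_le_add_left (ih h.2) 1).trans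
      (Module.supportDim_quotSMulTop_succ_le_of_notMem_minimalPrimes fun p hp =>
        h.1.notMem_of_mem_minimalPrimes hp)

variable {K : Type*} [Field K] {n : ℕ}

theorem aeval_C_mul_X_of_isHomogeneous {f : MvPolynomial (Fin n) K} {d : ℕ}
    (hf : f.IsHomogeneous d) (p : Fin n → K) :
    aeval (fun i => Polynomial.C (p i) * Polynomial.X : Fin n → Polynomial K) f =
      Polynomial.C (eval p f) * Polynomial.X ^ d := by
  rw [aeval_def, eval₂_eq, eval_eq, map_sum, Finset.sum_mul]
  refine Finset.sum_congr rfl fun u hu => ?_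
  have hd := hf.degree_eq_sum_deg_support hu
  simp only [mul_pow, Finset.prod_mul_distrib, Finset.prod_pow_eq_pow_sum, ← hd, map_mul,
    map_prod, map_pow, mul_assoc]
  rfl

/-- The forms in a regular sequence of length `n` in `n` variables have no nontrivial common
zero. -/
theorem eq_zero_of_isRegular {f : Fin n → MvPolynomial (Fin n) K} {d : ℕ}
    (hf : ∀ i, (f i).IsHomogeneous d) (hreg : IsRegular (MvPolynomial (Fin n) K) (List.ofFn f))
    {p : Fin n → K} (hp : ∀ i, eval p (f i) = 0) : p = 0 := by
  by_contra hp0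
  obtain ⟨i, hi⟩ := Function.ne_iff.1 hp0
  -- Restriction to the line through `p`; it is onto because some coordinate of `p` is nonzero.
  let φ : MvPolynomial (Fin n) K →ₐ[K] Polynomial K :=
    aeval fun i => Polynomial.C (p i) * Polynomial.X
  have hφ : Function.Surjective φ := by
    have : φ.comp (Polynomial.aeval (C (p i)⁻¹ * X i)) = AlgHom.id K _ := by
      refine Polynomial.algHom_ext ?_
      simp only [AlgHom.comp_apply, Polynomial.aeval_X, map_mul, MvPolynomial.algHom_C, φ,
        aeval_X, AlgHom.id_apply, Polynomial.algebraMap_eq]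
      rw [← mul_assoc, ← Polynomial.C_mul, inv_mul_cancel₀ hi, Polynomial.C_1, one_mul]
    exact fun q => ⟨_, AlgHom.congr_fun this q⟩
  set I := Ideal.ofList (List.ofFn f) with hI
  have hIφ : ∀ a ∈ I, φ a = 0 := by
    intro a ha
    have : I ≤ RingHom.ker φ := by
      refine Ideal.span_le.2 fun x hx => ?_
      obtain ⟨j, rfl⟩ := (List.mem_ofFn' f x).1 hx
      change φ (f j) = 0
      rw [aeval_C_mul_X_of_isHomogeneous (hf j), hp, map_zero, zero_mul]
    exact this ha
  -- The quotient by `I` maps onto a polynomial ring in one variable, so its dimension is at least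
  -- 1; regularity gives dimension plus n at most n.
  have h1 : ringKrullDim (Polynomial K) ≤ ringKrullDim (MvPolynomial (Fin n) K ⧸ I) :=
    ringKrullDim_le_of_surjective (Ideal.Quotient.lift I φ.toRingHom hIφ)
      (Ideal.Quotient.lift_surjective_of_surjective _ _ hφ)
  have h2 := supportDim_quotient_add_length_le _ hreg.toIsWeaklyRegular
  have hII : I • (⊤ : Submodule (MvPolynomial (Fin n) K) (MvPolynomial (Fin n) K)) = I := by
    simp
  rw [← hI, hII, Module.supportDim_quotient_eq_ringKrullDim, Module.supportDim_self_eq_ringKrullDim,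
    MvPolynomial.ringKrullDim_of_isNoetherianRing, ringKrullDim_eq_zero_of_field] at h2
  rw [Polynomial.ringKrullDim_of_isNoetherianRing, ringKrullDim_eq_zero_of_field] at h1
  have h3 := (add_le_add_left h1 _).trans h2
  simp only [List.length_ofFn, Nat.card_eq_fintype_card, Fintype.card_fin, zero_add] at h3
  have h4 : ((1 + n : ℕ) : WithBot ℕ∞) ≤ (n : ℕ) := by exact_mod_cast h3
  have := Nat.cast_le.1 h4
  omega

/-- In a nontrivial relation the last form that occurs lies in the ideal of the earlier ones. It is
then both zero and a nonzerodivisor on their quotient, which must vanish, against properness. -/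
theorem linearIndependent_of_isRegular {f : Fin n → MvPolynomial (Fin n) K}
    (hreg : IsRegular (MvPolynomial (Fin n) K) (List.ofFn f)) : LinearIndependent K f := by
  classical
  rw [Fintype.linearIndependent_iff]
  intro c hsum
  by_contra! hcon
  obtain ⟨k, hk⟩ := hcon
  obtain ⟨i, hi, hmax⟩ := Finset.exists_max_image (Finset.univ.filter fun k => c k ≠ 0) id
    ⟨k, by simp [hk]⟩
  simp only [Finset.mem_filter, Finset.mem_univ, true_and, id_eq] at hi hmax
  have hmem : f i ∈ Ideal.ofList ((List.ofFn f).take i) := by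
    have h0 : f i = ∑ j ∈ Finset.univ.erase i, (-(c i)⁻¹ * c j) • f j := by
      rw [← Finset.add_sum_erase _ _ (Finset.mem_univ i)] at hsum
      simp only [mul_smul, ← Finset.smul_sum]
      rw [eq_neg_of_add_eq_zero_right hsum, smul_neg, neg_smul, neg_neg, smul_smul,
        inv_mul_cancel₀ hi, one_smul]
    rw [h0]
    refine Ideal.sum_mem _ fun j hj => ?_
    by_cases hcj : c j = 0
    · simp [hcj]
    · have hji : j < i := lt_of_le_of_ne (hmax j hcj) (Finset.ne_of_mem_erase hj)
      rw [smul_eq_C_mul]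
      refine Ideal.mul_mem_left _ _ (Ideal.subset_span ?_)
      refine List.mem_take_iff_getElem.2 ⟨j, by simpa using hji, by simp⟩
  have h := hreg.regular_mod_prev i (by simp)
  have hz : (Submodule.Quotient.mk (1 : MvPolynomial (Fin n) K) : MvPolynomial (Fin n) K ⧸
      (Ideal.ofList ((List.ofFn f).take i) • ⊤ :
        Submodule (MvPolynomial (Fin n) K) (MvPolynomial (Fin n) K))) = 0 := by
    apply h
    simp only [List.getElem_ofFn, smul_zero]
    rw [← Submodule.Quotient.mk_smul, Submodule.Quotient.mk_eq_zero]
    simpa using hmem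
  rw [Submodule.Quotient.mk_eq_zero] at hz
  refine hreg.top_ne_smul ((Ideal.eq_top_iff_one _).2 ?_).symm
  refine Submodule.smul_mono_left (Ideal.span_mono fun x hx => ?_) hz
  exact List.mem_of_mem_take hx

end RegularSequence

/-! ### Leading monomials avoid the last variable -/

section LastVariable

open scoped MonomialOrder

variable {K : Type*} [Field K] {n : ℕ}

theorem eval_smul_of_isHomogeneous {f : MvPolynomial (Fin n) K} {d : ℕ}
    (hf : f.IsHomogeneous d) (p : Fin n → K) (t : K) :
    eval (fun i => t * p i) f = t ^ d * eval p f := by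
  rw [eval_eq, eval_eq, Finset.mul_sum]
  refine Finset.sum_congr rfl fun u hu => ?_
  have hd := hf.degree_eq_sum_deg_support hu
  simp only [mul_pow, Finset.prod_mul_distrib, Finset.prod_pow_eq_pow_sum, ← hd]
  ring

/-- A form of positive degree has a zero on every coordinate line. -/
theorem exists_ne_zero_eval_eq_zero [IsAlgClosed K] [CharZero K] {q : MvPolynomial (Fin n) K}
    {e : ℕ} (hq : q.IsHomogeneous e) (he : e ≠ 0) {a b : Fin n} (hab : a ≠ b) :
    ∃ p : Fin n → K, p ≠ 0 ∧ (∀ i, i ≠ a → i ≠ b → p i = 0) ∧ eval p q = 0 := by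
  by_contra! hcon
  -- Without zeros on the line, `q` restricted to the affine chart where coordinate `b` is 1 has no
  -- root, hence is constant.
  have key : ∀ a b : Fin n, a ≠ b → (∀ p : Fin n → K, p ≠ 0 →
      (∀ i, i ≠ a → i ≠ b → p i = 0) → eval p q ≠ 0) →
      ∃ c, ∀ t, eval (fun i => if i = a then t else if i = b then 1 else 0) q = c := by
    intro a b hab hcon
    let r : Polynomial K := aeval (fun i => if i = a then Polynomial.X else if i = b then 1 else 0) q
    have hr : ∀ t, r.eval t = eval (fun i => if i = a then t else if i = b then 1 else 0) q := by
      intro t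
      rw [← Polynomial.coe_evalRingHom, map_aeval]
      refine eval₂Hom_congr ?_ ?_ rfl
      · ext x
        simp
      · ext i
        split_ifs <;> simp
    by_cases hdeg : r.degree = 0
    · refine ⟨r.coeff 0, fun t => ?_⟩
      rw [← hr, Polynomial.eq_C_of_degree_eq_zero hdeg]
      simp
    · obtain ⟨t, ht⟩ := IsAlgClosed.exists_root r hdeg
      rw [Polynomial.IsRoot.def, hr] at ht
      refine absurd ht (hcon _ (fun h => ?_) fun i hia hib => by simp [hia, hib])
      have := congrFun h b
      simp [hab.symm] at this
  obtain ⟨c, hc⟩ := key a b hab hcon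
  obtain ⟨c', hc'⟩ := key b a hab.symm fun p hp hz => hcon p hp fun i hia hib => hz i hib hia
  -- Homogeneity compares the constants of the two charts; t = 1 and t = 2 then force both to
  -- vanish, as 2 ^ e ≠ 1 in characteristic zero.
  have hrel : ∀ t : K, t ≠ 0 → c = t ^ e * c' := fun t ht => by
    rw [← hc t, ← hc' t⁻¹, ← eval_smul_of_isHomogeneous hq]
    congr 2
    ext i
    by_cases hia : i = a
    · subst hia
      simp [hab]
    · by_cases hib : i = b
      · subst hib
        simp [hab.symm, ht]
      · simp [hia, hib]
  have h1 := hrel 1 one_ne_zero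
  have h2 := hrel 2 two_ne_zero
  rw [one_pow, one_mul] at h1
  have hc0 : c = 0 := by
    have h3 : ((2 : K) ^ e - 1) * c = 0 := by
      rw [h1] at h2 ⊢
      linear_combination -h2
    refine (mul_eq_zero.1 h3).resolve_left fun h => ?_
    have h4 : (2 : K) ^ e = 1 := sub_eq_zero.1 h
    have h5 : 2 ^ e = 1 := by exact_mod_cast h4
    simp [he] at h5
  refine hcon (fun i => if i = a then 1 else if i = b then 1 else 0) (fun h => ?_)
    (fun i hia hib => by simp [hia, hib]) ((hc 1).trans hc0)
  simpa using congrFun h a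

theorem last_le_of_le {u z : Fin (n + 1) →₀ ℕ} (hdeg : u.degree = z.degree)
    (h : z ≼[revlex (n + 1)] u) : u (Fin.last n) ≤ z (Fin.last n) := by
  by_contra! hlt
  refine h.not_gt (revlex_lt_iff.2 (Or.inr ⟨hdeg, Fin.last n, hlt, fun j hj => ?_⟩))
  exact absurd hj (Fin.le_last j).not_gt

/-- In generic coordinates, no leading monomial of a base point free space of forms of degree at
least two, of dimension at most the number of variables, involves the last variable. -/
theorem IsGenericInDegree.last_eq_zero [IsAlgClosed K] [CharZero K] (hn : 2 ≤ n)
    {V : Submodule K (MvPolynomial (Fin (n + 1)) K)} {d : ℕ} (hd : 2 ≤ d)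
    (hV : V ≤ homogeneousSubmodule (Fin (n + 1)) K d) (hrank : Module.finrank K V ≤ n + 1)
    {g : GL (Fin (n + 1)) K} (hg : IsGenericInDegree V d g)
    (hzero : ∀ p, (∀ q ∈ transform g V, eval p q = 0) → p = 0)
    {u : Fin (n + 1) →₀ ℕ} (hu : u ∈ leadExps (transform g V)) : u (Fin.last n) = 0 := by
  classical
  by_contra hk
  have hW := transform_le_homogeneousSubmodule hV g
  have hud := degree_eq_of_mem_leadExps hW hu
  obtain ⟨v, hv, hvu⟩ := hu
  obtain ⟨c, rfl⟩ : ∃ c, u = c + Finsupp.single (Fin.last n) 1 :=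
    ⟨u - Finsupp.single (Fin.last n) 1, (tsub_add_cancel_of_le (by
      rw [Finsupp.single_le_iff]; omega)).symm⟩
  set N := (degreeExps (n + 1) d).filter fun z => z (Fin.last n) < c (Fin.last n) + 1 with hN
  have hmemN : ∀ z, z ∈ N ↔ z.degree = d ∧ z (Fin.last n) < c (Fin.last n) + 1 := fun z => by
    simp [hN]
  have hvN : ∀ z ∈ N, coeff z v = 0 := fun z hz => by
    by_contra hz0
    rw [hmemN] at hz
    have hle : z ≼[revlex (n + 1)] c + Finsupp.single (Fin.last n) 1 := by
      by_contra hlt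
      exact hz0 (hvu.2 z (not_le.1 hlt))
    have := last_le_of_le (hud.trans hz.1.symm) hle
    simp only [Finsupp.coe_add, Pi.add_apply, Finsupp.single_eq_same] at this
    omega
  -- For the last variable `v` itself serves: both sides vanish on `N`. For the others the
  -- deformation applies, since c + e_j lies in `N`.
  have hex : ∀ j, ∃ w ∈ transform g V, IsLeadExp w (c + Finsupp.single j 1) ∧
      ∀ z ∈ N, coeff z w = coeff z (X j * pderiv (Fin.last n) v) := by
    intro j
    by_cases hj : j = Fin.last n
    · subst hj
      refine ⟨v, hv, hvu, fun z hz => ?_⟩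
      rw [hvN z hz, coeff_X_mul']
      split_ifs with hzs
      · rw [coeff_pderiv, tsub_add_cancel_of_le, hvN z hz, zero_mul]
        rw [Finsupp.single_le_iff]
        rw [Finsupp.mem_support_iff] at hzs
        omega
      · rfl
    · refine (hg N (Finset.filter_subset _ _)).exists_isLeadExp hV (fun z hz z' hz' hlt => ?_) hv
        hvN hj hvu ?_
      · rw [hmemN] at hz ⊢
        exact ⟨hz', (last_le_of_le (hz'.trans hz.1.symm) hlt.le).trans_lt hz.2⟩
      · rw [hmemN]
        refine ⟨?_, by simp [hj]⟩
        rw [← hud]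
        simp
  choose w hwW hwl hwN using hex
  have hind : LinearIndependent K w :=
    linearIndependent_of_isLeadExp w (fun j => c + Finsupp.single j 1)
      (fun _ _ hij => Finsupp.single_left_injective one_ne_zero (add_left_cancel hij)) hwl
  have hspan : Submodule.span K (Set.range w) = transform g V := by
    have := finite_of_le_homogeneousSubmodule hW
    refine Submodule.eq_of_le_of_finrank_le (Submodule.span_le.2 ?_) ?_
    · rintro _ ⟨j, rfl⟩
      exact hwW j
    · rw [finrank_span_eq_card hind, finrank_transform]
      simpa using hrank
  have hpd : (pderiv (Fin.last n) v).IsHomogeneous (d - 1) := IsHomogeneous.pderiv (hW hv)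
  -- The derivative has positive degree because d ≥ 2, and n ≥ 2 leaves two coordinates besides the
  -- last, so the zero can be taken with last coordinate 0.
  obtain ⟨p, hp0, hpz, hpe⟩ := exists_ne_zero_eval_eq_zero hpd (by omega)
    (a := ⟨0, by omega⟩) (b := ⟨1, by omega⟩) (by simp)
  have hlast : p (Fin.last n) = 0 := hpz _ (by simp [Fin.ext_iff]; omega)
    (by simp [Fin.ext_iff]; omega)
  have hvan : ∀ q : MvPolynomial (Fin (n + 1)) K, (∀ z, z (Fin.last n) = 0 → coeff z q = 0) →
      eval p q = 0 := fun q hq => by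
    rw [eval_eq']
    refine Finset.sum_eq_zero fun z _ => ?_
    by_cases hz : z (Fin.last n) = 0
    · rw [hq z hz, zero_mul]
    · rw [Finset.prod_eq_zero (Finset.mem_univ (Fin.last n)) (by rw [hlast, zero_pow hz]), mul_zero]
  have hwp : ∀ j, eval p (w j) = 0 := fun j => by
    have := hvan (w j - X j * pderiv (Fin.last n) v) fun z hz => by
      by_cases hzd : z.degree = d
      · rw [coeff_sub, hwN j z ((hmemN z).2 ⟨hzd, by omega⟩), sub_self]
      · have hh : (X j * pderiv (Fin.last n) v).IsHomogeneous d := by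
          have := (isHomogeneous_X K j).mul hpd
          rwa [show 1 + (d - 1) = d by omega] at this
        exact (IsHomogeneous.sub (hW (hwW j)) hh).coeff_eq_zero hzd
    rw [map_sub, map_mul, hpe, mul_zero, sub_zero] at this
    exact this
  refine hp0 (hzero p fun q hq => ?_)
  rw [← hspan] at hq
  have hle : Submodule.span K (Set.range w) ≤ LinearMap.ker (aeval p).toLinearMap := by
    refine Submodule.span_le.2 ?_
    rintro _ ⟨j, rfl⟩
    simpa [aeval_eq_eval] using hwp j
  simpa [aeval_eq_eval] using hle hq

theorem eval_coordChange (g : GL (Fin n) K) (p : Fin n → K) (f : MvPolynomial (Fin n) K) :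
    eval p (coordChange g f) = eval (g.val.mulVec p) f := by
  induction f using MvPolynomial.induction_on with
  | C a => rw [MvPolynomial.algHom_C]; simp
  | add p q hp hq => simp only [map_add, hp, hq]
  | mul_X q i hq =>
    rw [map_mul, map_mul, hq, map_mul, coordChange_X]
    simp [Matrix.mulVec, dotProduct]

theorem eq_zero_of_forall_mem_transform {f : Fin n → MvPolynomial (Fin n) K} {d : ℕ}
    (hf : ∀ i, (f i).IsHomogeneous d)
    (hreg : RingTheory.Sequence.IsRegular (MvPolynomial (Fin n) K) (List.ofFn f))
    (g : GL (Fin n) K) {p : Fin n → K}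
    (hp : ∀ q ∈ transform g (Submodule.span K (Set.range f)), eval p q = 0) : p = 0 := by
  have h := eq_zero_of_isRegular hf hreg (p := g.val.mulVec p) fun i => by
    rw [← eval_coordChange]
    exact hp _ (mem_transform.2 ⟨f i, Submodule.subset_span ⟨i, rfl⟩, rfl⟩)
  have := congrArg (g⁻¹).val.mulVec h
  rwa [Matrix.mulVec_mulVec, ← Units.val_mul, inv_mul_cancel, Units.val_one, Matrix.one_mulVec,
    Matrix.mulVec_zero] at this

end LastVariable

/-! ### Strongly stable sets that are revlex sets -/

section StronglyStable

open scoped MonomialOrder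

variable {n : ℕ}

/-- With `x_j x^c` the set contains `x_i x^c` for all `i < j`. -/
def IsStronglyStable (A : Set (Fin n →₀ ℕ)) : Prop :=
  ∀ i j : Fin n, i < j → ∀ c : Fin n →₀ ℕ, c + Finsupp.single j 1 ∈ A → c + Finsupp.single i 1 ∈ A

theorem IsStronglyStable.add_single {A : Set (Fin n →₀ ℕ)} (hA : IsStronglyStable A)
    {i j : Fin n} (hij : i < j) (m : ℕ) (c : Fin n →₀ ℕ) (h : c + Finsupp.single j m ∈ A) :
    c + Finsupp.single i m ∈ A := by
  induction m generalizing c with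
  | zero => simpa using h
  | succ m ih =>
    rw [Finsupp.single_add, ← add_assoc] at h ⊢
    have := hA i j hij _ h
    rw [add_right_comm] at this ⊢
    exact ih _ this

theorem IsStronglyStable.mem_of_move {A : Set (Fin n →₀ ℕ)} (hA : IsStronglyStable A)
    {i j : Fin n} (hij : i < j) {u v : Fin n →₀ ℕ} (hu : u ∈ A) (m : ℕ) (hi : v i = u i + m)
    (hj : u j = v j + m) (hk : ∀ k, k ≠ i → k ≠ j → v k = u k) : v ∈ A := by
  have h1 : u = (u - Finsupp.single j m) + Finsupp.single j m :=
    (tsub_add_cancel_of_le (by rw [Finsupp.single_le_iff]; omega)).symm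
  have h2 : v = (u - Finsupp.single j m) + Finsupp.single i m := by
    ext k
    by_cases hki : k = i
    · subst hki
      simp [hi, hij.ne]
    · by_cases hkj : k = j
      · subst hkj
        simp [hij.ne', hj]
      · simp [hk k hki hkj, Ne.symm hki, Ne.symm hkj]
  rw [h2]
  rw [h1] at hu
  exact hA.add_single hij m _ hu

/-- Only two variables occur, and there the moves x_1 ↦ x_0 reach every larger monomial. -/
theorem IsStronglyStable.isRevlexSet_fin_three {A : Set (Fin 3 →₀ ℕ)} (hA : IsStronglyStable A)
    (hlast : ∀ u ∈ A, u 2 = 0) : IsRevlexSet A := by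
  intro u hu v hdeg hlt
  have hu2 := hlast u hu
  rw [revlex_lt_iff, hdeg] at hlt
  obtain ⟨-, i, hi, hij⟩ := hlt.resolve_left (lt_irrefl _)
  simp only [Finsupp.degree_eq_sum, Fin.sum_univ_three] at hdeg
  fin_cases i
  · have h1 := hij 1 (by decide)
    have h2 := hij 2 (by decide)
    simp only [Fin.zero_eta] at hi
    omega
  · have h2 := hij 2 (by decide)
    simp only [Fin.mk_one] at hi
    refine hA.mem_of_move (i := 0) (j := 1) (by decide) hu (u 1 - v 1) (by omega) (by omega) ?_
    intro k h0 h1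
    fin_cases k <;> simp_all
  · simp only [Fin.reduceFinMk] at hi
    omega

theorem IsStronglyStable.isRevlexSet_fin_four {A : Set (Fin 4 →₀ ℕ)} (hA : IsStronglyStable A)
    (hdegA : ∀ u ∈ A, u.degree = 2) (hlast : ∀ u ∈ A, u 3 = 0) (hcard : A.ncard = 4) :
    IsRevlexSet A := by
  -- Such a `v` arises from `u` by two moves: from x_2 to x_0 and x_1 if the exponent of x_1 grows,
  -- otherwise from x_2 and x_1 to x_0.
  have hmove : ∀ u ∈ A, ∀ v : Fin 4 →₀ ℕ, v.degree = u.degree → v 3 = u 3 → u 0 ≤ v 0 →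
      v 2 ≤ u 2 → v ∈ A := by
    intro u hu v hdeg h3 h0 h2
    simp only [Finsupp.degree_eq_sum, Fin.sum_univ_four] at hdeg
    rcases le_total (u 1) (v 1) with h1 | h1
    · let w : Fin 4 →₀ ℕ := Finsupp.equivFunOnFinite.symm ![v 0, u 1, u 2 - (v 0 - u 0), u 3]
      have hw : w ∈ A := by
        refine hA.mem_of_move (i := 0) (j := 2) (by decide) hu (v 0 - u 0) ?_ ?_ ?_
        · simp [w]; omega
        · simp [w]; omega
        · intro k _ _
          fin_cases k <;> simp_all [w]
      refine hA.mem_of_move (i := 1) (j := 2) (by decide) hw (v 1 - u 1) ?_ ?_ ?_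
      · simp [w]; omega
      · simp [w]; omega
      · intro k _ _
        fin_cases k <;> simp_all [w]
    · let w : Fin 4 →₀ ℕ := Finsupp.equivFunOnFinite.symm ![u 0 + (u 2 - v 2), u 1, v 2, u 3]
      have hw : w ∈ A := by
        refine hA.mem_of_move (i := 0) (j := 2) (by decide) hu (u 2 - v 2) ?_ ?_ ?_
        · simp [w]
        · simp [w]; omega
        · intro k _ _
          fin_cases k <;> simp_all [w]
      refine hA.mem_of_move (i := 0) (j := 1) (by decide) hw (u 1 - v 1) ?_ ?_ ?_
      · simp [w]; omega
      · simp [w]; omega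
      · intro k _ _
        fin_cases k <;> simp_all [w]
  -- The monomial x_1² is present: otherwise, by stability, every member is divisible by x_0,
  -- leaving only x_0², x_0x_1, x_0x_2, fewer than four.
  have hsq : ∀ v : Fin 4 →₀ ℕ, v.degree = 2 → v 1 = 2 → v ∈ A := by
    intro v hv hv1
    by_contra hvA
    have hv' := hv
    simp only [Finsupp.degree_eq_sum, Fin.sum_univ_four] at hv'
    have hsub : A ⊆ ((Finset.univ.image fun k : Fin 3 =>
        (Finsupp.single 0 1 + Finsupp.single k.castSucc 1 : Fin 4 →₀ ℕ) : Finset _) :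
          Set (Fin 4 →₀ ℕ)) := by
      intro z hz
      have hz2 := hdegA z hz
      have hz3 := hlast z hz
      have hz0 : z 0 ≠ 0 := fun hz0 =>
        hvA (hmove z hz v (hv.trans hz2.symm) (by omega) (by omega) (by omega))
      simp only [Finsupp.degree_eq_sum, Fin.sum_univ_four] at hz2
      have : ∃ k : Fin 3, (Finsupp.single 0 1 + Finsupp.single k.castSucc 1 : Fin 4 →₀ ℕ) = z := by
        rcases (by omega : z 0 = 2 ∨ z 1 = 1 ∨ z 2 = 1) with h | h | h
        · refine ⟨0, ?_⟩
          ext k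
          fin_cases k <;> simp <;> omega
        · refine ⟨1, ?_⟩
          ext k
          fin_cases k <;> simp <;> omega
        · refine ⟨2, ?_⟩
          ext k
          fin_cases k <;> simp <;> omega
      simpa using this
    have h1 := Set.ncard_le_ncard hsub (Finset.finite_toSet _)
    rw [hcard, Set.ncard_coe_finset] at h1
    have h2 := h1.trans Finset.card_image_le
    simp at h2
  intro u hu v hdeg hlt
  have hu3 := hlast u hu
  have hu2 := hdegA u hu
  have hv2 := hdeg.trans hu2
  rw [revlex_lt_iff, hdeg] at hlt
  obtain ⟨-, i, hi, hij⟩ := hlt.resolve_left (lt_irrefl _)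
  have hdeg' := hdeg
  have hv2' := hv2
  simp only [Finsupp.degree_eq_sum, Fin.sum_univ_four] at hdeg' hv2'
  fin_cases i
  · have h1 := hij 1 (by decide)
    have h2 := hij 2 (by decide)
    have h3 := hij 3 (by decide)
    simp only [Fin.zero_eta] at hi
    omega
  · have h2 := hij 2 (by decide)
    have h3 := hij 3 (by decide)
    simp only [Fin.mk_one] at hi
    exact hmove u hu v hdeg h3.symm (by omega) h2.ge
  · have h3 := hij 3 (by decide)
    simp only [Fin.reduceFinMk] at hi
    by_cases h0 : u 0 ≤ v 0
    · exact hmove u hu v hdeg h3.symm h0 hi.le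
    -- Degree 2 forces u = x_0x_2 and v = x_1², the pair not settled by strong stability.
    · exact hsq v hv2 (by omega)
  · simp only [Fin.reduceFinMk] at hi
    omega

end StronglyStable

/-! ### Passage to the generic initial ideal -/

section Main

variable {K : Type*} [Field K] {n : ℕ}

/-- If `in(g I)_d` is a revlex set for general `g`, then so is `Gin(I)_d`. -/
theorem HasComponents.isRevlexSet_of_isGin [CharZero K] {I J : Ideal (MvPolynomial (Fin n) K)}
    (hI : HasComponents I) (hJ : IsGin I J) {d : ℕ}
    (h : ∀ g, IsGenericInDegree (homogPart I d) d g →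
      IsRevlexSet (leadExps (transform g (homogPart I d)))) :
    IsRevlexSet (monomialsOfDegree J d) := by
  have : Infinite K := .of_injective _ Nat.cast_injective
  obtain ⟨U, ⟨T, hT⟩, ⟨g₀, hg₀⟩, hU⟩ := hJ
  rw [hT] at hg₀
  obtain ⟨q, hqT, hq⟩ := hg₀
  have hqU : ∀ g : GL (Fin n) K, eval (fun ij => g.val ij.1 ij.2) q ≠ 0 → g ∈ U := fun g hg => by
    rw [hT]
    exact ⟨q, hqT, hg⟩
  obtain ⟨p, hp, hp0, hpg⟩ := exists_isGenericInDegree (homogPart I d) d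
  let r : GL (Fin n) K → K := fun g => eval (fun ij => g.val ij.1 ij.2) q
  have hr : r ∈ glPolynomials K n := mem_glPolynomials.2 ⟨q, fun _ => rfl⟩
  have hr0 : r ≠ 0 := fun h => hq (congrFun h g₀)
  -- The open set witnessing `IsGin` is arbitrary; by irreducibility of GL_n it meets the locus of
  -- generic coordinates.
  obtain ⟨g, hg⟩ := Function.ne_iff.1 (mul_ne_zero_of_mem_glPolynomials hp hr hp0 hr0)
  rw [Pi.mul_apply] at hg
  rw [← hU g (hqU g (right_ne_zero_of_mul hg)),
    (hI.map_coordChange g).monomialsOfDegree_initialIdeal, homogPart_map_coordChange]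
  exact h g (hpg g (left_ne_zero_of_mul hg))

theorem IsGenericInDegree.isStronglyStable [CharZero K]
    {V : Submodule K (MvPolynomial (Fin n) K)} {d : ℕ}
    (hV : V ≤ homogeneousSubmodule (Fin n) K d) {g : GL (Fin n) K}
    (hg : IsGenericInDegree V d g) : IsStronglyStable (leadExps (transform g V)) :=
  fun _ _ hij _ hc => hg.add_single_mem_leadExps hV hij hc

/-- The leading exponents of general coordinate changes of the forms in a regular sequence do not
involve the last variable. -/
theorem IsGenericInDegree.last_eq_zero_of_isRegular [IsAlgClosed K] [CharZero K] (hn : 2 ≤ n)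
    {d : ℕ} (hd : 2 ≤ d) {f : Fin (n + 1) → MvPolynomial (Fin (n + 1)) K}
    (hf : ∀ i, (f i).IsHomogeneous d)
    (hreg : RingTheory.Sequence.IsRegular (MvPolynomial (Fin (n + 1)) K) (List.ofFn f))
    {g : GL (Fin (n + 1)) K}
    (hg : IsGenericInDegree (homogPart (Ideal.span (Set.range f)) d) d g) :
    ∀ u ∈ leadExps (transform g (homogPart (Ideal.span (Set.range f)) d)),
      u (Fin.last n) = 0 := by
  intro u hu
  refine hg.last_eq_zero hn hd (homogPart_le _ _) ?_ (fun p hp => ?_) hu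
  · rw [homogPart_span_range hf]
    exact (finrank_range_le_card (R := K) f).trans (by simp)
  · rw [homogPart_span_range hf] at hp
    exact eq_zero_of_forall_mem_transform hf hreg g hp

end Main

end

theorem proposition1p8 {K : Type*} [Field K] [IsAlgClosed K] [CharZero K] :
    (∀ d : ℕ, 2 ≤ d → ∀ f : Fin 3 → MvPolynomial (Fin 3) K,
      (∀ i, (f i).IsHomogeneous d) →
      RingTheory.Sequence.IsRegular (MvPolynomial (Fin 3) K) (List.ofFn f) →
      (∃ J, IsGin (Ideal.span (Set.range f)) J) ∧
        ∀ J, IsGin (Ideal.span (Set.range f)) J → IsRevlexSet (monomialsOfDegree J d)) ∧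
    (∀ f : Fin 4 → MvPolynomial (Fin 4) K,
      (∀ i, (f i).IsHomogeneous 2) →
      RingTheory.Sequence.IsRegular (MvPolynomial (Fin 4) K) (List.ofFn f) →
      (∃ J, IsGin (Ideal.span (Set.range f)) J) ∧
        ∀ J, IsGin (Ideal.span (Set.range f)) J → IsRevlexSet (monomialsOfDegree J 2)) := by
  have : Infinite K := .of_injective _ Nat.cast_injective
  constructor
  · intro d hd f hf hreg
    have hI := hasComponents_span_range hf
    refine ⟨hI.exists_isGin, fun J hJ => hI.isRevlexSet_of_isGin hJ fun g hg => ?_⟩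
    exact (hg.isStronglyStable (homogPart_le _ _)).isRevlexSet_fin_three
      (hg.last_eq_zero_of_isRegular le_rfl hd hf hreg)
  · intro f hf hreg
    have hI := hasComponents_span_range hf
    refine ⟨hI.exists_isGin, fun J hJ => hI.isRevlexSet_of_isGin hJ fun g hg => ?_⟩
    have hW := transform_le_homogeneousSubmodule (homogPart_le (Ideal.span (Set.range f)) 2) g
    refine (hg.isStronglyStable (homogPart_le _ _)).isRevlexSet_fin_four
      (fun u hu => degree_eq_of_mem_leadExps hW hu)
      (hg.last_eq_zero_of_isRegular (by norm_num) le_rfl hf hreg) ?_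
    rw [ncard_leadExps hW, finrank_transform, homogPart_span_range hf,
      finrank_span_eq_card (linearIndependent_of_isRegular hreg), Fintype.card_fin]
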